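/- **Setting.** Indices $\mu,\nu,\alpha,\beta,\dots$ run over $1,2,3,4$, indices $i,j$ over $1,2,3$; repeated indices are summed; $\eta=\mathrm{diag}(1,1,1,-1)$ raises and lowers indices. For $a=(a_1,a_2,a_3)\in C(\mathbb R,\mathbb R^3)$ let $W(\tau)$ be the $4\times4$ matrix with $W^i{}_4=W^4{}_i=a_i(\tau)$ and all other entries $0$, and let $\Lambda^\mu{}_\nu(\tau)$ be the solution of $\dot\Lambda=\Lambda W$, $\Lambda(0)=1$. Put $G^\mu{}_\rho(\tau,t)=\Lambda_\nu{}^\mu(\tau)\Lambda^\nu{}_\rho(t)$. Let $M$ be the space of all $(\xi,\tau,a)\in\mathbb R^3\times\mathbb R\times C(\mathbb R,\mathbb R^3)$ with $1+\xi\cdot a(\tau)>0$ (Fermi–Walker coordinates together with the acceleration functions of the frame, the interval being $ds^2=d\xi^2-(1+\xi\cdot a(\tau))^2d\tau^2$). Put $\hat\partial_i=\partial/\partial\xi^i$, $\hat\partial_4=(1+\xi\cdot a(\tau))^{-1}\partial_\tau$ and define the vector fields on $M$ $$P_\mu=\Lambda_\mu{}^\nu(\tau)\,\hat\partial_\nu,\qquad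 J_{\alpha\beta}=k_\beta P_\alpha-k_\alpha P_\beta,\qquad k^\beta=\Lambda^\beta{}_j(\tau)\xi^j+\int_0^\tau\Lambda^\beta{}_4(t)\,dt,$$ $$D_{i(t)}=\frac{\delta}{\delta a^i(t)}+\chi(t,\tau)\left[\Lambda^{\mu4}(t)\,\Delta^i(\tau,t,\xi)-\Lambda^{\mu i}(t)\,\Delta^4(\tau,t,\xi)\right]P_\mu,$$ where $\Delta^\nu(\tau,t,\xi)=\xi^jG_j{}^\nu(\tau,t)+\int_t^\tau G_4{}^\nu(s,t)\,ds$, $\chi(t,\tau)=\theta(t)\theta(\tau-t)-\theta(-t)\theta(t-\tau)$ and $\theta$ is the Heaviside function. The $D_{i(t)}$ are understood as distributions in $t$, that is, through the vector fields $D_A=\int_{\mathbb R}\sum_iA_i(t)D_{i(t)}\,dt$ with $A\in C(\mathbb R,\mathbb R^3)$, where $\int\sum_iA_i(t)\frac{\delta}{\delta a^i(t)}dt$ is the derivative in the direction $A$ of the space of accelerations. Lie brackets are computed in the frame $\hat\partial_\mu$, whose only non-zero commutators are $[\hat\partial_i,\hat\partial_4]=-\frac{a_i(\tau)}{1+\xi\cdot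 a(\tau)}\hat\partial_4$ and $\left[\int\sum_iA_i(t)\frac{\delta}{\delta a^i(t)}dt,\hat\partial_4\right]=-\frac{\xi\cdot A(\tau)}{1+\xi\cdot a(\tau)}\hat\partial_4$; where $a$ is differentiable this is the usual Lie bracket in the coordinates $(\xi,\tau,a)$. **Theorem.** 1. The generators are infinitesimal generalised isometries: for every differentiable $a$, with $g_{\mu\nu}(x,a)$ the metric $d\xi^2-(1+\xi\cdot a(\tau))^2d\tau^2$ and $X^\alpha$ the components of $P_\mu$ (with $A=0$), of $J_{\alpha\beta}$ (with $A=0$) or of $D_A$ in the coordinates $(\xi,\tau)$, the generalised Killing equation $$X^\alpha\partial_\alpha g_{\mu\nu}+\partial_\nu X^\alpha g_{\alpha\mu}+\partial_\mu X^\alpha g_{\alpha\nu}+\sum_iA_i(\tau)\frac{\partial g_{\mu\nu}}{\partial a_i}=0$$ holds on the region $1+\xi\cdot a(\tau)>0$. 2. On $M$ all the following brackets exist, and $$[P_\mu,P_\nu]=0,\qquad[J_{\alpha\beta},P_\mu]=\eta_{\mu\alpha}P_\beta-\eta_{\mu\beta}P_\alpha,$$ $$[J_{\alpha\beta},J_{\mu\nu}]=\eta_{\mu\alpha}J_{\beta\nu}-\eta_{\mu\beta}J_{\alpha\nu}-\eta_{\nu\alpha}J_{\beta\mu}+\eta_{\nu\beta}J_{\alpha\mu},$$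 $$[D_{i(t)},P_\mu]=0,\qquad[D_{i(t)},J_{\alpha\beta}]=0,\qquad[D_{i(t)},D_{j(t')}]=0,$$ the last line meaning $[D_A,P_\mu]=[D_A,J_{\alpha\beta}]=[D_A,D_B]=0$ for all $A,B\in C(\mathbb R,\mathbb R^3)$. 3. Consequently the real vector space spanned by all $P_\mu$, $J_{\alpha\beta}$ and $D_A$, with this bracket, is a Lie algebra which is an extension of the Poincaré algebra $\mathbb R^4\rtimes\mathfrak{so}(3,1)$ by the infinite-dimensional abelian Lie algebra $\{D_A\}\cong C(\mathbb R,\mathbb R^3)$. -/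

import Mathlib

open scoped Matrix Topology

noncomputable section

namespace FermiWalker

/-! ### Indices, the Minkowski metric, accelerations -/

/-- Spacetime indices: `Sum.inl i` are the three space indices, `Sum.inr ()` is the time index
(the index `4`). -/
abbrev Idx : Type := Fin 3 ⊕ Unit

/-- The time index `4`. -/
abbrev time : Idx := Sum.inr ()

/-- The Minkowski metric `diag[1,1,1,-1]`; it coincides with its inverse. -/
def eta : Matrix Idx Idx ℝ := LieAlgebra.Orthogonal.indefiniteDiagonal (Fin 3) Unit ℝ

/-- Triples `a = (a₁,a₂,a₃)` of continuous functions on `ℝ`. -/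
abbrev Accel : Type := C(ℝ, Fin 3 → ℝ)

/-! ### Fermi-Walker transport -/

/-- The matrix `W^β_α = [0₃ | a ; a | 0]` (row `β`, column `α`). -/
def boostMatrix (v : Fin 3 → ℝ) : Matrix Idx Idx ℝ :=
  Matrix.fromBlocks 0 (Matrix.replicateCol Unit v) (Matrix.replicateRow Unit v) 0

/-- `Λ` solves `dΛ^μ_ν/dτ = Λ^μ_β W^β_ν(τ)` with `Λ(0) = 1`. -/
def IsTransportMatrix (a : Accel) (L : ℝ → Matrix Idx Idx ℝ) : Prop :=
  L 0 = 1 ∧ ∀ τ μ ν, HasDerivAt (fun s => L s μ ν) ((L τ * boostMatrix (a τ)) μ ν) τ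

/-- Iterated integrals whose sum solves `L' = L W`, `L 0 = 1`. -/
def dysonTerm {B : Type*} [NormedRing B] [NormedAlgebra ℝ B] (W : ℝ → B) : ℕ → ℝ → B
  | 0 => fun _ => 1
  | n + 1 => fun t => ∫ s in (0 : ℝ)..t, dysonTerm W n s * W s

theorem continuous_dysonTerm {B : Type*} [NormedRing B] [NormedAlgebra ℝ B] [CompleteSpace B]
    {W : ℝ → B} (hW : Continuous W) (n : ℕ) : Continuous (dysonTerm W n) := by
  induction n with
  | zero => exact continuous_const
  | succ n ih =>
    exact intervalIntegral.continuous_primitive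
      (fun a b => (ih.mul hW).intervalIntegrable a b) 0

theorem hasDerivAt_dysonTerm {B : Type*} [NormedRing B] [NormedAlgebra ℝ B] [CompleteSpace B]
    {W : ℝ → B} (hW : Continuous W) (n : ℕ) (t : ℝ) :
    HasDerivAt (dysonTerm W (n + 1)) (dysonTerm W n t * W t) t :=
  intervalIntegral.integral_hasDerivAt_right
    (((continuous_dysonTerm hW n).mul hW).intervalIntegrable 0 t)
    ((continuous_dysonTerm hW n).mul hW).aestronglyMeasurable.stronglyMeasurableAtFilter
    ((continuous_dysonTerm hW n).mul hW).continuousAt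

theorem norm_dysonTerm_le {B : Type*} [NormedRing B] [NormedAlgebra ℝ B] [CompleteSpace B]
    {W : ℝ → B} {T K : ℝ} (hK : ∀ s, |s| ≤ T → ‖W s‖ ≤ K) (n : ℕ) :
    ∀ t, |t| ≤ T → ‖dysonTerm W n t‖ ≤ ‖(1 : B)‖ * (K ^ n * (|t| ^ n / n.factorial)) := by
  induction n with
  | zero => intro t _; simp [dysonTerm]
  | succ n ih =>
    intro t ht
    have hK0 : 0 ≤ K := (norm_nonneg _).trans (hK t ht)
    have hbound : ∀ᵐ s, s ∈ Set.uIoc 0 t → ‖dysonTerm W n s * W s‖ ≤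
        ‖(1 : B)‖ * K ^ (n + 1) / n.factorial * |s - 0| ^ n := by
      refine Filter.Eventually.of_forall fun s hs => ?_
      have hsT : |s| ≤ T := by
        refine le_trans ?_ ht
        have := Set.abs_sub_left_of_mem_uIcc (Set.uIoc_subset_uIcc hs)
        simpa using this
      calc ‖dysonTerm W n s * W s‖ ≤ ‖dysonTerm W n s‖ * ‖W s‖ := norm_mul_le _ _
        _ ≤ (‖(1 : B)‖ * (K ^ n * (|s| ^ n / n.factorial))) * K :=
          mul_le_mul (ih s hsT) (hK s hsT) (norm_nonneg _) (by positivity)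
        _ = _ := by rw [sub_zero]; ring
    have hint : IntervalIntegrable
        (fun s : ℝ => ‖(1 : B)‖ * K ^ (n + 1) / n.factorial * |s - 0| ^ n) MeasureTheory.volume 0 t :=
      (by fun_prop : Continuous fun s : ℝ =>
        ‖(1 : B)‖ * K ^ (n + 1) / n.factorial * |s - 0| ^ n).intervalIntegrable 0 t
    have h1 := intervalIntegral.norm_integral_le_abs_of_norm_le
      ((MeasureTheory.ae_restrict_iff' measurableSet_uIoc).2 hbound) hint
    refine h1.trans (le_of_eq ?_)
    rw [intervalIntegral.integral_const_mul, abs_mul,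
      intervalIntegral.abs_intervalIntegral_eq, integral_pow_abs_sub_uIoc,
      abs_of_nonneg (by positivity), abs_of_nonneg (by positivity), sub_zero, Nat.factorial_succ]
    push_cast
    field_simp

theorem exists_linear_solution {B : Type*} [NormedRing B] [NormedAlgebra ℝ B] [CompleteSpace B]
    {W : ℝ → B} (hW : Continuous W) :
    ∃ L : ℝ → B, L 0 = 1 ∧ ∀ t, HasDerivAt L (L t * W t) t := by
  have hkey : ∀ T : ℝ, 0 < T → ∃ K : ℝ, 0 ≤ K ∧ ∀ s, |s| ≤ T → ‖W s‖ ≤ K := by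
    intro T _
    obtain ⟨K, hK⟩ := (isCompact_Icc (a := -T) (b := T)).exists_bound_of_continuousOn
      hW.continuousOn
    exact ⟨max K 0, le_max_right _ _, fun s hs => (hK s (abs_le.1 hs)).trans (le_max_left _ _)⟩
  have hsumm : ∀ T : ℝ, 0 < T → ∀ K : ℝ, Summable fun n : ℕ =>
      ‖(1 : B)‖ * (K ^ n * (T ^ n / n.factorial)) := by
    intro T _ K
    refine Summable.mul_left _ ((Real.summable_pow_div_factorial (K * T)).congr fun n => ?_)
    rw [mul_pow]; ring
  have hs : ∀ t, Summable fun n => dysonTerm W n t := by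
    intro t
    obtain ⟨K, hK0, hK⟩ := hkey (|t| + 1) (by positivity)
    refine Summable.of_norm_bounded (hsumm (|t| + 1) (by positivity) K) fun n => ?_
    refine (norm_dysonTerm_le hK n t (by linarith)).trans ?_
    gcongr
    linarith
  refine ⟨fun t => ∑' n, dysonTerm W n t, ?_, fun t => ?_⟩
  · change ∑' n, dysonTerm W n 0 = 1
    rw [tsum_eq_single 0]
    · rfl
    · intro n hn
      obtain ⟨m, rfl⟩ := Nat.exists_eq_succ_of_ne_zero hn
      simp [dysonTerm]
  · obtain ⟨K, hK0, hK⟩ := hkey (|t| + 1) (by positivity)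
    have hd := hasDerivAt_tsum_of_isPreconnected (𝕜 := ℝ)
      (g := fun n => dysonTerm W (n + 1)) (g' := fun n y => dysonTerm W n y * W y)
      (u := fun n => ‖(1 : B)‖ * (K ^ n * ((|t| + 1) ^ n / n.factorial)) * K)
      (t := Metric.ball 0 (|t| + 1)) (y₀ := t) (y := t)
      ((hsumm (|t| + 1) (by positivity) K).mul_right K) Metric.isOpen_ball
      (convex_ball _ _).isPreconnected (fun n y _ => hasDerivAt_dysonTerm hW n y)
      (fun n y hy => by
        have hy' : |y| ≤ |t| + 1 := by
          rw [mem_ball_zero_iff, Real.norm_eq_abs] at hy; exact hy.le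
        refine (norm_mul_le _ _).trans (mul_le_mul ?_ (hK y hy') (norm_nonneg _) (by positivity))
        refine (norm_dysonTerm_le hK n y hy').trans ?_
        gcongr)
      (by simp) ((summable_nat_add_iff 1).2 (hs t)) (by simp)
    rw [(hs t).tsum_mul_right] at hd
    refine (hd.const_add (1 : B)).congr_of_eventuallyEq (Filter.Eventually.of_forall fun z => ?_)
    change ∑' n, dysonTerm W n z = 1 + ∑' n, dysonTerm W (n + 1) z
    rw [(hs z).tsum_eq_zero_add]
    rfl

theorem continuous_boostMatrix : Continuous boostMatrix := by
  refine continuous_matrix fun i j => ?_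
  rcases i with i | i <;> rcases j with j | j <;> simp [boostMatrix] <;> fun_prop

section
attribute [local instance] Matrix.linftyOpNormedRing Matrix.linftyOpNormedAlgebra

theorem exists_isTransportMatrix (a : Accel) : ∃ L, IsTransportMatrix a L := by
  obtain ⟨L, h0, h1⟩ := exists_linear_solution
    (W := fun τ => boostMatrix (a τ)) (continuous_boostMatrix.comp a.continuous)
  refine ⟨L, h0, fun τ μ ν => ?_⟩
  let e : Matrix Idx Idx ℝ →ₗ[ℝ] ℝ := Matrix.entryLinearMap ℝ ℝ μ ν
  exact (LinearMap.toContinuousLinearMap e).hasFDerivAt.comp_hasDerivAt τ (h1 τ)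

end

/-- The transport matrix `Λ^μ_ν(τ)` (row `μ`, column `ν`) of the acceleration `a`. -/
def transport (a : Accel) : ℝ → Matrix Idx Idx ℝ := (exists_isTransportMatrix a).choose

theorem isTransportMatrix_transport (a : Accel) : IsTransportMatrix a (transport a) :=
  (exists_isTransportMatrix a).choose_spec

/-- `Λ_μ^ν(τ) = η_{μα} Λ^α_β(τ) η^{βν}` (row `μ`, column `ν`). -/
def transportLower (a : Accel) (τ : ℝ) : Matrix Idx Idx ℝ := eta * transport a τ * eta

/-- `Λ^{μν}(τ) = Λ^μ_β(τ) η^{βν}`. -/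
def transportUpper (a : Accel) (τ : ℝ) : Matrix Idx Idx ℝ := transport a τ * eta

/-- `G^μ_ρ(τ,t) = Λ_ν^μ(τ) Λ^ν_ρ(t)` (row `μ`, column `ρ`). -/
def green (a : Accel) (τ t : ℝ) : Matrix Idx Idx ℝ := (transportLower a τ)ᵀ * transport a t

/-- `G_ρ^μ(τ,t) = η_{ρα} G^α_β(τ,t) η^{βμ}` (row `ρ`, column `μ`). -/
def greenLower (a : Accel) (τ t : ℝ) : Matrix Idx Idx ℝ := eta * green a τ t * eta

/-! ### The space of Fermi-Walker coordinates and accelerations -/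

/-- `1 + ξ · a(τ)`, where `x = (ξ¹,ξ²,ξ³,τ)`. -/
def lapse (x : Idx → ℝ) (a : Accel) : ℝ := 1 + ∑ i : Fin 3, x (Sum.inl i) * a (x time) i

/-- The space with coordinates `(ξ¹,ξ²,ξ³,τ,[a_i(t)])`, where `1 + ξ · a(τ) > 0`. -/
abbrev FWSpace : Type := {p : (Idx → ℝ) × Accel // 0 < lapse p.1 p.2}

namespace FWSpace

/-- The spacetime coordinates `(ξ,τ)`. -/
def x (p : FWSpace) : Idx → ℝ := p.val.1
/-- The acceleration functions. -/
def a (p : FWSpace) : Accel := p.val.2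
/-- The time coordinate. -/
def τ (p : FWSpace) : ℝ := p.x time
/-- The space coordinates. -/
def ξ (p : FWSpace) (i : Fin 3) : ℝ := p.x (Sum.inl i)

end FWSpace

/-- A tangent vector is given by its components `V^μ` in the frame
`∂̂_i = ∂/∂ξ^i`, `∂̂_4 = (1 + ξ·a(τ))⁻¹ ∂/∂τ`, and by its component `A` along the accelerations:
`(V, A)` stands for `V^μ ∂̂_μ + ∫ dt Σ_i A_i(t) δ/δa^i(t)`. -/
abbrev Tangent : Type := (Idx → ℝ) × Accel

/-- Vector fields. -/
abbrev Field : Type := FWSpace → Tangent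

/-- The displacement of the coordinates `(ξ,τ,a)` that corresponds to a tangent vector: the
component along `∂/∂τ` is `V^4 / (1 + ξ·a(τ))`. -/
def toCoord (p : FWSpace) (V : Tangent) : Tangent :=
  (Sum.elim (fun i => V.1 (Sum.inl i)) (fun _ => V.1 time / lapse p.x p.a), V.2)

/-- `f` has the directional derivative `f'` at `p` in the direction of the coordinate
displacement `w`. -/
def HasDerivAlong {F : Type*} [AddCommGroup F] [Module ℝ F] [TopologicalSpace F]
    [ContinuousSMul ℝ F] (f : FWSpace → F) (p : FWSpace) (w : Tangent) (f' : F) : Prop :=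
  HasDerivAt (fun s : ℝ => Function.extend Subtype.val f 0 (p.val + s • w)) f' 0

/-- The part of the Lie bracket that comes from the frame itself, i.e. from
`[∂̂_i, ∂̂_4] = - a_i(τ) (1 + ξ·a(τ))⁻¹ ∂̂_4` and
`[∫ dt Σ_i A_i(t) δ/δa^i(t), ∂̂_4] = - ξ·A(τ) (1 + ξ·a(τ))⁻¹ ∂̂_4` (all the other commutators of
frame fields vanish). -/
def frameBracket (p : FWSpace) (U V : Tangent) : Tangent :=
  let c : Tangent → ℝ := fun T => ∑ i : Fin 3, (T.1 (Sum.inl i) * p.a p.τ i + p.ξ i * T.2 p.τ i)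
  (Pi.single time (-(c U * V.1 time - c V * U.1 time) / lapse p.x p.a), 0)

/-- `[X, Y] = Z` at `p`: the components of `Y` have a derivative `U` along `X`, those of `X` have a
derivative `V` along `Y`, and `Z = U - V +` (commutator of the frame fields). Computing in the frame
gives a meaning to the bracket also where `a` is only continuous. Where `a` is differentiable, this
is the usual Lie bracket in the coordinates `(ξ,τ,a)`: see `HasLieBracketAt.coord`. -/
def HasLieBracketAt (X Y Z : Field) (p : FWSpace) : Prop :=
  ∃ U V : Tangent,
    HasDerivAlong (fun q => (Y q).1) p (toCoord p (X p)) U.1 ∧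
    HasDerivAlong (fun q => (Y q).2) p (toCoord p (X p)) U.2 ∧
    HasDerivAlong (fun q => (X q).1) p (toCoord p (Y p)) V.1 ∧
    HasDerivAlong (fun q => (X q).2) p (toCoord p (Y p)) V.2 ∧
    Z p = U - V + frameBracket p (X p) (Y p)

/-- `[X, Y] = Z` on the whole space. -/
def IsLieBracket (X Y Z : Field) : Prop := ∀ p, HasLieBracketAt X Y Z p

theorem hasDerivAt_lapse (p : FWSpace) (w : Tangent) {a' : Fin 3 → ℝ}
    (ha : HasDerivAt p.a a' p.τ) :
    HasDerivAt (fun s : ℝ => lapse (p.val + s • w).1 (p.val + s • w).2)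
      (∑ i : Fin 3, (w.1 (Sum.inl i) * p.a p.τ i + p.ξ i * w.2 p.τ i
        + p.ξ i * (a' i * w.1 time))) 0 := by
  have hline : HasDerivAt (fun s : ℝ => p.x time + s * w.1 time) (w.1 time) 0 := by
    simpa using ((hasDerivAt_id (0 : ℝ)).mul_const (w.1 time)).const_add (p.x time)
  have hterm : ∀ i : Fin 3, HasDerivAt (fun s : ℝ =>
      (p.ξ i + s * w.1 (Sum.inl i)) *
        (p.a (p.x time + s * w.1 time) i + s * w.2 (p.x time + s * w.1 time) i))
      (w.1 (Sum.inl i) * p.a p.τ i + p.ξ i * w.2 p.τ i + p.ξ i * (a' i * w.1 time)) 0 := by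
    intro i
    have h1 : HasDerivAt (fun s : ℝ => p.ξ i + s * w.1 (Sum.inl i)) (w.1 (Sum.inl i)) 0 := by
      simpa using ((hasDerivAt_id (0 : ℝ)).mul_const (w.1 (Sum.inl i))).const_add (p.ξ i)
    have h2 : HasDerivAt (fun s : ℝ => p.a (p.x time + s * w.1 time) i) (a' i * w.1 time) 0 := by
      have h := hasDerivAt_pi.1 ha i
      have h' : HasDerivAt (fun t => p.a t i) (a' i) (p.x time + 0 * w.1 time) := by
        rw [zero_mul, add_zero]; exact h
      exact HasDerivAt.comp (h₂ := fun t => p.a t i) (0 : ℝ) h' hline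
    have h3 : HasDerivAt (fun s : ℝ => s * w.2 (p.x time + s * w.1 time) i) (w.2 p.τ i) 0 := by
      rw [hasDerivAt_iff_tendsto_slope]
      have hc : Continuous fun s : ℝ => w.2 (p.x time + s * w.1 time) i := by fun_prop
      have hc0 := (hc.tendsto 0).mono_left (nhdsWithin_le_nhds (s := {0}ᶜ))
      simp only [zero_mul, add_zero] at hc0
      refine hc0.congr' ?_
      filter_upwards [self_mem_nhdsWithin] with s hs
      have hs' : s ≠ 0 := hs
      simp [slope, hs']
    have h := h1.fun_mul (h2.fun_add h3)
    refine h.congr_deriv ?_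
    simp only [zero_mul, add_zero, FWSpace.τ]
    ring
  have hsum := (HasDerivAt.fun_sum (u := Finset.univ) fun i _ => hterm i).const_add (1 : ℝ)
  refine hsum.congr_of_eventuallyEq (Filter.Eventually.of_forall fun s => ?_)
  simp [lapse, FWSpace.ξ, FWSpace.x, FWSpace.a]

/-- Where `a` is differentiable, the Lie bracket is the usual one in the coordinates `(ξ,τ,a)`:
the derivative of the components of `Y` along `X` minus that of the components of `X` along `Y`. -/
theorem HasLieBracketAt.coord {X Y Z : Field} {p : FWSpace} (h : HasLieBracketAt X Y Z p)
    (ha : DifferentiableAt ℝ p.a p.τ) :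
    ∃ U V : Tangent,
      HasDerivAlong (fun q => (toCoord q (Y q)).1) p (toCoord p (X p)) U.1 ∧
      HasDerivAlong (fun q => (toCoord q (Y q)).2) p (toCoord p (X p)) U.2 ∧
      HasDerivAlong (fun q => (toCoord q (X q)).1) p (toCoord p (Y p)) V.1 ∧
      HasDerivAlong (fun q => (toCoord q (X q)).2) p (toCoord p (Y p)) V.2 ∧
      toCoord p (Z p) = U - V := by
  have hN : lapse p.x p.a ≠ 0 := p.property.ne'
  let a' : Fin 3 → ℝ := deriv p.a p.τ
  let d : Tangent → ℝ := fun w => ∑ i : Fin 3, (w.1 (Sum.inl i) * p.a p.τ i + p.ξ i * w.2 p.τ i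
        + p.ξ i * (a' i * w.1 time))
  have key : ∀ (Q : Field) (w D : Tangent), HasDerivAlong (fun q => (Q q).1) p w D.1 →
      HasDerivAlong (fun q => (toCoord q (Q q)).1) p w
        (Sum.elim (fun i => D.1 (Sum.inl i)) (fun _ =>
          (D.1 time * lapse p.x p.a - (Q p).1 time * d w) / lapse p.x p.a ^ 2)) := by
    intro Q w D hD
    have hl := hasDerivAt_lapse p w ha.hasDerivAt
    have hpos : ∀ᶠ s : ℝ in 𝓝 0, 0 < lapse (p.val + s • w).1 (p.val + s • w).2 := by
      refine hl.continuousAt.eventually (lt_mem_nhds ?_)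
      simpa using p.property
    have hev : ∀ f : FWSpace → (Idx → ℝ), ∀ q : FWSpace,
        Function.extend Subtype.val f 0 q.val = f q := fun f q =>
      Subtype.val_injective.extend_apply f 0 q
    have hD' := hasDerivAt_pi.1 hD
    have h0 : Function.extend (Subtype.val : FWSpace → Tangent) (fun q => (Q q).1) 0
        (p.val + (0 : ℝ) • w) = (Q p).1 := by
      have hz : p.val + (0 : ℝ) • w = p.val := by simp
      rw [hz]
      exact hev _ p
    refine hasDerivAt_pi.2 fun μ => ?_
    rcases μ with i | ⟨⟩
    · refine (hD' (Sum.inl i)).congr_of_eventuallyEq ?_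
      filter_upwards [hpos] with s hs
      rw [hev _ ⟨p.val + s • w, hs⟩, hev _ ⟨p.val + s • w, hs⟩]
      rfl
    · have hq := (hD' time).fun_div hl (by simpa [FWSpace.x, FWSpace.a] using hN)
      refine (hq.congr_deriv ?_).congr_of_eventuallyEq ?_
      · rw [h0]
        simp [d, a', FWSpace.x, FWSpace.a]
      · filter_upwards [hpos] with s hs
        rw [hev _ ⟨p.val + s • w, hs⟩, hev _ ⟨p.val + s • w, hs⟩]
        rfl
  obtain ⟨U, V, hU1, hU2, hV1, hV2, hZ⟩ := h
  refine ⟨(_, U.2), (_, V.2), key Y _ U hU1, hU2, key X _ V hV1, hV2, ?_⟩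
  rw [hZ]
  refine Prod.ext ?_ ?_
  · funext μ
    rcases μ with i | ⟨⟩
    · simp [toCoord, frameBracket]
    · simp only [toCoord, frameBracket, d, Sum.elim_inr, Sum.elim_inl, Prod.fst_add, Prod.fst_sub,
        Pi.add_apply, Pi.sub_apply, Pi.single_eq_same, Finset.sum_add_distrib,
        Fin.sum_univ_three]
      field_simp
      ring
  · simp [toCoord, frameBracket]

/-! ### The generators -/

/-- `P_μ = Λ_μ^ν(τ) ∂̂_ν`. -/
def transGen (μ : Idx) : Field := fun p => (fun ν => transportLower p.a p.τ μ ν, 0)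

/-- `k^β = Λ^β_j(τ) ξ^j + ∫_0^τ Λ^β_4(t) dt`. -/
def kUpper (p : FWSpace) (β : Idx) : ℝ :=
  ∑ j : Fin 3, transport p.a p.τ β (Sum.inl j) * p.ξ j
    + ∫ t in (0 : ℝ)..p.τ, transport p.a t β time

/-- `k_α = η_{αβ} k^β`. -/
def kLower (p : FWSpace) (α : Idx) : ℝ := ∑ β, eta α β * kUpper p β

/-- `J_{αβ} = k_β P_α - k_α P_β`. -/
def lorentzGen (α β : Idx) : Field := fun p =>
  kLower p β • transGen α p - kLower p α • transGen β p

/-- `Δ^ν(τ,t,ξ) = ξ^j G_j^ν(τ,t) + ∫_t^τ G_4^ν(s,t) ds`. -/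
def delta (p : FWSpace) (t : ℝ) (ν : Idx) : ℝ :=
  ∑ j : Fin 3, p.ξ j * greenLower p.a p.τ t (Sum.inl j) ν
    + ∫ s in t..p.τ, greenLower p.a s t time ν

/-- The Heaviside function. -/
def heaviside (s : ℝ) : ℝ := if 0 ≤ s then 1 else 0

/-- `χ(t,τ) = θ(t) θ(τ-t) - θ(-t) θ(t-τ)`. -/
def chi (t τ : ℝ) : ℝ :=
  heaviside t * heaviside (τ - t) - heaviside (-t) * heaviside (t - τ)

/-- The coefficient of `P_μ` in
`D_{i(t)} = δ/δa^i(t) + 2 χ(t,τ) Λ^{μ[4}(t) Δ^{i]}(τ,t,ξ) P_μ`. -/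
def boostKernel (p : FWSpace) (i : Fin 3) (t : ℝ) (μ : Idx) : ℝ :=
  chi t p.τ * (transportUpper p.a t μ time * delta p t (Sum.inl i)
    - transportUpper p.a t μ (Sum.inl i) * delta p t time)

/-- `D_A = ∫ dt Σ_i A_i(t) D_{i(t)}`. -/
def boostGen (A : Accel) : Field := fun p =>
  (∑ μ, (∫ t, ∑ i, A t i * boostKernel p i t μ) • (transGen μ p).1, A)

/-- The space spanned by the generators `P_μ`, `J_{αβ}` and `D_A`. -/
def generatorSpan : Submodule ℝ Field :=
  Submodule.span ℝ (Set.range transGen ∪ Set.range (fun q : Idx × Idx => lorentzGen q.1 q.2)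
    ∪ Set.range boostGen)

/-! ### Infinitesimal generalised isometries -/

/-- The Fermi-Walker metric `dξ² - (1 + ξ·v)² dτ²` at `x = (ξ,τ)`, for the value `v` of the
acceleration. -/
def metric (x : Idx → ℝ) (v : Fin 3 → ℝ) : Matrix Idx Idx ℝ :=
  Matrix.diagonal (Sum.elim (fun _ => 1) (fun _ => -(1 + ∑ i : Fin 3, x (Sum.inl i) * v i) ^ 2))

/-- The generalised Killing equation
`X^α ∂_α g_{μν} + ∂_ν X^α g_{αμ} + ∂_μ X^α g_{αν} + Σ_i A_i ∂g_{μν}/∂a_i = 0`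
on the region `1 + ξ·a(τ) > 0`; here `X` has the components `X^α` in the coordinates `(ξ,τ)`, and
`g_{μν} = g_{μν}(x, a(τ))`. -/
def IsInfinitesimalGeneralisedIsometry (a : Accel) (X : (Idx → ℝ) → (Idx → ℝ)) (A : Accel) :
    Prop :=
  ∀ x : Idx → ℝ, 0 < lapse x a → DifferentiableAt ℝ X x ∧ ∀ μ ν : Idx,
    ∑ α, X x α * fderiv ℝ (fun y => metric y (a (y time)) μ ν) x (Pi.single α 1)
    + ∑ α, fderiv ℝ X x (Pi.single ν 1) α * metric x (a (x time)) α μ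
    + ∑ α, fderiv ℝ X x (Pi.single μ 1) α * metric x (a (x time)) α ν
    + ∑ i : Fin 3, A (x time) i *
        fderiv ℝ (fun v => metric x v μ ν) (a (x time)) (Pi.single i 1) = 0

/-- The components in the coordinates `(ξ,τ)` of a vector field, for fixed `a`. -/
def Field.atAccel (V : Field) (a : Accel) : (Idx → ℝ) → (Idx → ℝ) := fun x =>
  Function.extend Subtype.val (fun q => (toCoord q (V q)).1) 0 (x, a)

/-! ### The Poincaré algebra -/

/-- The Lorentz algebra `so(3,1)`. -/
abbrev Lorentz : Type := LieAlgebra.Orthogonal.so' (Fin 3) Unit ℝ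

/-- The translations, as an abelian Lie algebra. -/
instance : LieRing (Idx → ℝ) where
  bracket _ _ := 0
  add_lie _ _ _ := by simp
  lie_add _ _ _ := by simp
  lie_self _ := by simp
  leibniz_lie _ _ _ := by simp

instance : LieAlgebra ℝ (Idx → ℝ) where
  lie_smul _ _ _ := (smul_zero _).symm

/-- The acceleration triples, as an abelian Lie algebra. -/
instance : LieRing Accel where
  bracket _ _ := 0
  add_lie _ _ _ := by simp
  lie_add _ _ _ := by simp
  lie_self _ := by simp
  leibniz_lie _ _ _ := by simp

instance : LieAlgebra ℝ Accel where
  lie_smul _ _ _ := (smul_zero _).symm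

theorem translation_lie (v w : Idx → ℝ) : ⁅v, w⁆ = 0 := rfl

/-- The Lorentz algebra acts on the translations by matrix multiplication. -/
def lorentzAction : Lorentz →ₗ⁅ℝ⁆ LieDerivation ℝ (Idx → ℝ) (Idx → ℝ) where
  toFun M := ⟨Matrix.mulVecLin M.1, fun v w => by simp [translation_lie]⟩
  map_add' M N := by ext v : 1; simp
  map_smul' c M := by ext v : 1; simp
  map_lie' {M N} := by
    ext v : 1
    simp [LieRing.of_associative_ring_bracket, Matrix.mulVec_mulVec]

/-- The Poincaré algebra `ℝ⁴ ⋊ so(3,1)`. -/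
abbrev Poincare : Type := LieAlgebra.SemiDirectSum (Idx → ℝ) Lorentz lorentzAction

end FermiWalker

end

open FermiWalker

noncomputable section

namespace FermiWalker

/-! For fixed `a`, the event with Fermi–Walker coordinates `(ξ,τ)` has inertial coordinates `k = Λ_j
ξ^j + z(τ)`, where `z` is the world line of the origin (`position`). Varying `a` in the direction
`A` moves the frame at time `τ` by an infinitesimal Poincaré transformation: with `φ_A = ∫ Λ W_A
Λ⁻¹` and `θ_A = ∫ Λ W_A Λ⁻¹ z`, both from `0` to `τ`, one has `δΛ = φ_A Λ` and `δz = φ_A z - θ_A`,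
hence `δk = φ_A k - θ_A` at fixed `(ξ,τ)`.

Subtracting this motion turns the pair of an infinitesimal Poincaré transformation `k ↦ M k + c` and
a direction `A` into a field with inertial components `M k + c - φ_A k + θ_A` (`liftField`). Along
it `k` changes exactly by `M k + c`. All generators are such lifts: `P_μ` has `c = e_μ`, `J_{αβ}`
has `M = e_α η_β - e_β η_α`, and `D_A` has `c = 0`, `M = 0`, so it changes the frame while every
event stays fixed.

Lifts therefore bracket like the Poincaré fields, and the directions `A` contribute nothing
(`isLieBracket_liftField`). The potential obstruction vanishes by the zero-curvature identity `δ_A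
φ_B - δ_B φ_A = [φ_A, φ_B]` and its analogue for `θ` (`integral_commutator_phi`,
`integral_commutator_theta`). As the `D_A` are central, the resulting algebra is the direct product
of the accelerations and the Poincaré algebra, realised faithfully by `liftPoincare`.

The Killing equation holds because `Λ⁻¹ (M - φ_A) Λ` is skew for the Minkowski form; the rest of the
frame derivative cancels the derivatives of the lapse
(`isInfinitesimalGeneralisedIsometry_liftField`). -/

/-- Four-vectors. -/
abbrev Vec : Type := Idx → ℝ

/-- The continuous linear operator of a matrix. -/
def op : Matrix Idx Idx ℝ →ₗ[ℝ] (Vec →L[ℝ] Vec) :=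
  LinearMap.toContinuousLinearMap.toLinearMap ∘ₗ Matrix.toLin'.toLinearMap

@[simp] theorem op_apply (M : Matrix Idx Idx ℝ) (v : Vec) : op M v = M *ᵥ v := rfl

theorem op_mul (M N : Matrix Idx Idx ℝ) : op (M * N) = op M * op N := by
  ext v : 1
  simp [Matrix.mulVec_mulVec]

theorem op_one : op 1 = 1 := by
  ext v : 1
  simp

/-- A linear map on matrices is a finite combination of entries, so entrywise derivatives suffice
and no norm on matrices has to be chosen. -/
theorem hasDerivAt_linearMap_comp {Y : Type*} [NormedAddCommGroup Y] [NormedSpace ℝ Y]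
    (φ : Matrix Idx Idx ℝ →ₗ[ℝ] Y) {F : ℝ → Matrix Idx Idx ℝ} {F' : Matrix Idx Idx ℝ} {t : ℝ}
    (h : ∀ μ ν, HasDerivAt (fun s => F s μ ν) (F' μ ν) t) :
    HasDerivAt (fun s => φ (F s)) (φ F') t := by
  have key : ∀ M : Matrix Idx Idx ℝ, φ M = ∑ μ, ∑ ν, M μ ν • φ (Matrix.single μ ν 1) := by
    intro M
    conv_lhs => rw [Matrix.matrix_eq_sum_single M]
    rw [map_sum]
    refine Finset.sum_congr rfl fun μ _ => ?_
    rw [map_sum]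
    refine Finset.sum_congr rfl fun ν _ => ?_
    rw [← map_smul, Matrix.smul_single, smul_eq_mul, mul_one]
  rw [funext fun s => key (F s), key F']
  exact HasDerivAt.fun_sum fun μ _ => HasDerivAt.fun_sum fun ν _ => (h μ ν).smul_const _

/-! ### The Minkowski metric and boost matrices. -/

theorem eta_mul_eta : eta * eta = 1 := by
  rw [eta, LieAlgebra.Orthogonal.indefiniteDiagonal, Matrix.diagonal_mul_diagonal,
    ← Matrix.diagonal_one]
  congr 1
  funext i
  rcases i with i | i <;> simp

theorem eta_transpose : etaᵀ = eta := by
  simp [eta, LieAlgebra.Orthogonal.indefiniteDiagonal]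

theorem eta_inl_left (i : Fin 3) (ν : Idx) :
    eta (Sum.inl i) ν = if Sum.inl i = ν then 1 else 0 := by
  simp [eta, LieAlgebra.Orthogonal.indefiniteDiagonal, Matrix.diagonal_apply]

theorem eta_time_left (ν : Idx) : eta time ν = if time = ν then -1 else 0 := by
  simp [eta, LieAlgebra.Orthogonal.indefiniteDiagonal, Matrix.diagonal_apply]

theorem eta_mulVec_inl (v : Vec) (i : Fin 3) : (eta *ᵥ v) (Sum.inl i) = v (Sum.inl i) := by
  simp [Matrix.mulVec, dotProduct, eta_inl_left]

theorem eta_mulVec_time (v : Vec) : (eta *ᵥ v) time = -v time := by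
  simp [Matrix.mulVec, dotProduct, eta_time_left]

theorem boostMatrix_mulVec_inl (b : Fin 3 → ℝ) (v : Vec) (i : Fin 3) :
    (boostMatrix b *ᵥ v) (Sum.inl i) = b i * v time := by
  simp [boostMatrix, Matrix.mulVec, dotProduct]

theorem boostMatrix_mulVec_time (b : Fin 3 → ℝ) (v : Vec) :
    (boostMatrix b *ᵥ v) time = ∑ i, b i * v (Sum.inl i) := by
  simp [boostMatrix, Matrix.mulVec, dotProduct]

theorem boostMatrix_transpose (b : Fin 3 → ℝ) : (boostMatrix b)ᵀ = boostMatrix b := by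
  ext (i | i) (j | j) <;> simp [boostMatrix]

theorem boostMatrix_mul_eta (b : Fin 3 → ℝ) : boostMatrix b * eta = -(eta * boostMatrix b) := by
  ext (i | i) (j | j) <;>
    simp [boostMatrix, eta, LieAlgebra.Orthogonal.indefiniteDiagonal, Matrix.mul_diagonal,
      Matrix.diagonal_mul]

theorem boostMatrix_add_smul (b c : Fin 3 → ℝ) (s : ℝ) :
    boostMatrix (b + s • c) = boostMatrix b + s • boostMatrix c := by
  ext (i | i) (j | j) <;> simp [boostMatrix]

/-- The operator `W` of the boost with acceleration `b`. -/
def boostOp (b : Fin 3 → ℝ) : Vec →L[ℝ] Vec := op (boostMatrix b)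

theorem boostOp_add_smul (b c : Fin 3 → ℝ) (s : ℝ) :
    boostOp (b + s • c) = boostOp b + s • boostOp c := by
  simp [boostOp, boostMatrix_add_smul]

@[fun_prop]
theorem continuous_boostOp : Continuous boostOp := by
  let f : (Fin 3 → ℝ) →ₗ[ℝ] (Vec →L[ℝ] Vec) :=
    { toFun := boostOp
      map_add' := fun b c => by simpa using boostOp_add_smul b c 1
      map_smul' := fun s c => by
        have h0 : boostOp 0 = 0 := by
          have := boostOp_add_smul 0 0 1
          simpa using this
        simpa [h0] using boostOp_add_smul 0 c s }
  exact f.continuous_of_finiteDimensional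

/-! ### The transport operator, its inverse and uniqueness. -/

/-- The operator of the transport matrix. -/
def transportOp (a : Accel) (t : ℝ) : Vec →L[ℝ] Vec := op (transport a t)

/-- The matrix inverse to the transport matrix, `η Λᵀ η`. -/
def transportInv (a : Accel) (t : ℝ) : Matrix Idx Idx ℝ := eta * (transport a t)ᵀ * eta

/-- The operator of the inverse of the transport matrix. -/
def transportInvOp (a : Accel) (t : ℝ) : Vec →L[ℝ] Vec := op (transportInv a t)

theorem transport_zero (a : Accel) : transport a 0 = 1 := (isTransportMatrix_transport a).1

theorem transportOp_zero (a : Accel) : transportOp a 0 = 1 := by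
  rw [transportOp, transport_zero, op_one]

theorem transportInvOp_zero (a : Accel) : transportInvOp a 0 = 1 := by
  rw [transportInvOp, transportInv, transport_zero, Matrix.transpose_one, mul_one, eta_mul_eta,
    op_one]

theorem hasDerivAt_transportOp (a : Accel) (t : ℝ) :
    HasDerivAt (transportOp a) (transportOp a t * boostOp (a t)) t := by
  rw [transportOp, boostOp, ← op_mul]
  exact hasDerivAt_linearMap_comp op ((isTransportMatrix_transport a).2 t)

/-- Transposing `Λ' = Λ W` gives `W Λᵀ`, since `W` is symmetric; moving `η` past `W` produces the
sign. -/
theorem hasDerivAt_transportInvOp (a : Accel) (t : ℝ) :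
    HasDerivAt (transportInvOp a) (-(boostOp (a t) * transportInvOp a t)) t := by
  let φ : Matrix Idx Idx ℝ →ₗ[ℝ] (Vec →L[ℝ] Vec) :=
    { toFun := fun M => op (eta * Mᵀ * eta)
      map_add' := fun M N => by simp [mul_add, add_mul]
      map_smul' := fun s M => by simp }
  refine (hasDerivAt_linearMap_comp φ ((isTransportMatrix_transport a).2 t)).congr_deriv ?_
  change op (eta * (transport a t * boostMatrix (a t))ᵀ * eta) = _
  rw [transportInvOp, boostOp, ← op_mul, ← map_neg, Matrix.transpose_mul, boostMatrix_transpose,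
    transportInv, ← mul_assoc, ← mul_assoc, ← mul_assoc, boostMatrix_mul_eta]
  simp

theorem eq_of_hasDerivAt_zero {Y : Type*} [NormedAddCommGroup Y] [NormedSpace ℝ Y] {f : ℝ → Y}
    (h : ∀ t, HasDerivAt f 0 t) (t : ℝ) : f t = f 0 :=
  is_const_of_deriv_eq_zero (fun s => (h s).differentiableAt) (fun s => (h s).deriv) t 0

/-- The two equations cancel in the derivative of the product. Allowing any solution `L` yields at
once the inverse of `Λ` and the uniqueness of solutions. -/
theorem mul_transportInvOp_of_hasDerivAt (a : Accel) {L : ℝ → Vec →L[ℝ] Vec} (h0 : L 0 = 1)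
    (h : ∀ t, HasDerivAt L (L t * boostOp (a t)) t) (t : ℝ) : L t * transportInvOp a t = 1 := by
  have := eq_of_hasDerivAt_zero (f := fun t => L t * transportInvOp a t) (fun s => by
    refine ((h s).fun_mul (hasDerivAt_transportInvOp a s)).congr_deriv ?_
    ext v : 1
    simp) t
  simpa [h0, transportInvOp_zero] using this

@[simp]
theorem transportOp_mul_inv (a : Accel) (t : ℝ) : transportOp a t * transportInvOp a t = 1 :=
  mul_transportInvOp_of_hasDerivAt a (transportOp_zero a) (hasDerivAt_transportOp a) t

theorem op_injective : Function.Injective op := fun _ _ h =>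
  Matrix.toLin'.injective (LinearMap.toContinuousLinearMap.injective h)

theorem transport_mul_inv (a : Accel) (t : ℝ) : transport a t * transportInv a t = 1 :=
  op_injective (by rw [op_mul, op_one]; exact transportOp_mul_inv a t)

theorem transportInv_mul (a : Accel) (t : ℝ) : transportInv a t * transport a t = 1 :=
  mul_eq_one_comm.1 (transport_mul_inv a t)

@[simp]
theorem transportInvOp_mul (a : Accel) (t : ℝ) : transportInvOp a t * transportOp a t = 1 := by
  rw [transportInvOp, transportOp, ← op_mul, transportInv_mul, op_one]

theorem eq_transportOp_of_hasDerivAt (a : Accel) {L : ℝ → Vec →L[ℝ] Vec} (h0 : L 0 = 1)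
    (h : ∀ t, HasDerivAt L (L t * boostOp (a t)) t) (t : ℝ) : L t = transportOp a t := by
  calc L t = L t * (transportInvOp a t * transportOp a t) := by simp
    _ = transportOp a t := by rw [← mul_assoc, mul_transportInvOp_of_hasDerivAt a h0 h, one_mul]

@[simp]
theorem transportOp_inv_apply (a : Accel) (t : ℝ) (v : Vec) :
    transportOp a t (transportInvOp a t v) = v :=
  congrArg (fun T : Vec →L[ℝ] Vec => T v) (transportOp_mul_inv a t)

@[simp]
theorem transportInvOp_transportOp_apply (a : Accel) (t : ℝ) (v : Vec) :
    transportInvOp a t (transportOp a t v) = v :=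
  congrArg (fun T : Vec →L[ℝ] Vec => T v) (transportInvOp_mul a t)

theorem continuous_transportOp (a : Accel) : Continuous (transportOp a) :=
  continuous_iff_continuousAt.2 fun t => (hasDerivAt_transportOp a t).continuousAt

theorem continuous_transportInvOp (a : Accel) : Continuous (transportInvOp a) :=
  continuous_iff_continuousAt.2 fun t => (hasDerivAt_transportInvOp a t).continuousAt

/-! ### Continuous dependence of the transport on a parameter. -/

/-- For compact `K` the family is a single linear equation in the Banach algebra `C(K, B)`; a
solution there is automatically jointly continuous in time and parameter. -/
theorem exists_linear_solution_family {K B : Type*} [TopologicalSpace K] [CompactSpace K]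
    [NormedRing B] [NormedAlgebra ℝ B] [CompleteSpace B] {W : ℝ → K → B}
    (hW : Continuous fun q : ℝ × K => W q.1 q.2) :
    ∃ L : ℝ → K → B, (∀ s, L 0 s = 1) ∧ (∀ s t, HasDerivAt (fun t => L t s) (L t s * W t s) t) ∧
      Continuous fun q : ℝ × K => L q.1 q.2 := by
  let V : C(ℝ, C(K, B)) := ContinuousMap.curry ⟨fun q : ℝ × K => W q.1 q.2, hW⟩
  obtain ⟨L, h0, h⟩ := exists_linear_solution (B := C(K, B)) (W := V) V.continuous
  refine ⟨fun t s => L t s, fun s => congrArg (fun f : C(K, B) => f s) h0, fun s t => ?_, ?_⟩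
  · let e : C(K, B) →L[ℝ] B := ContinuousMap.evalCLM ℝ s
    have he : HasFDerivAt e e (L t) := e.hasFDerivAt
    exact HasFDerivAt.comp_hasDerivAt (E := B) (F := C(K, B)) t he (h t)
  · have hc : Continuous L := continuous_iff_continuousAt.2 fun t =>
      HasDerivAt.continuousAt (F := C(K, B)) (h t)
    exact (hc.comp continuous_fst).eval continuous_snd

theorem continuous_transportOp_family (a A : Accel) :
    Continuous fun p : ℝ × ℝ => transportOp (a + p.1 • A) p.2 := by
  refine continuous_iff_continuousAt.2 fun p₀ => ?_
  obtain ⟨R, hR⟩ : ∃ R, |p₀.1| < R := ⟨|p₀.1| + 1, by linarith⟩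
  have hR' : -R ≤ R := by linarith [abs_nonneg p₀.1]
  have hW : Continuous fun q : ℝ × Set.Icc (-R) R => boostOp (a q.1 + (q.2 : ℝ) • A q.1) := by
    fun_prop
  obtain ⟨L, h0, h, hc⟩ := exists_linear_solution_family
    (W := fun t (s : Set.Icc (-R) R) => boostOp (a t + (s : ℝ) • A t)) hW
  have hL : ∀ (s : Set.Icc (-R) R) (t : ℝ), L t s = transportOp (a + (s : ℝ) • A) t := fun s =>
    eq_transportOp_of_hasDerivAt (a + (s : ℝ) • A) (L := fun t => L t s) (h0 s) (h s)
  -- Clamping the parameter to `[-R, R]` defines the family for every real parameter without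
  -- changing it near `p₀`.
  have hc' : Continuous fun p : ℝ × ℝ => L p.2 (Set.projIcc (-R) R hR' p.1) :=
    by
    have h1 : Continuous fun p : ℝ × ℝ => (p.2, Set.projIcc (-R) R hR' p.1) :=
      continuous_snd.prodMk (continuous_projIcc.comp continuous_fst)
    exact hc.comp h1
  refine hc'.continuousAt.congr ?_
  have hnhds : ∀ᶠ p : ℝ × ℝ in 𝓝 p₀, p.1 ∈ Set.Icc (-R) R :=
    continuous_fst.continuousAt (Icc_mem_nhds (abs_lt.1 hR).1 (abs_lt.1 hR).2)
  filter_upwards [hnhds] with p hp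
  rw [hL, Set.projIcc_of_mem hR' hp]

/-! ### Variations of functionals of the acceleration. -/

section Variation

variable {X Y Z : Type*} [NormedAddCommGroup X] [NormedSpace ℝ X] [NormedAddCommGroup Y]
  [NormedSpace ℝ Y] [NormedAddCommGroup Z] [NormedSpace ℝ Z] {a A : Accel}

/-- `F'` is the variation at `a` in the direction `A` of the functional `F` with values in the
functions of time; the difference quotients are required to be jointly continuous. -/
def HasVariation (F : Accel → ℝ → Y) (a A : Accel) (F' : ℝ → Y) : Prop :=
  ∃ Q : ℝ → ℝ → Y, (Continuous fun p : ℝ × ℝ => Q p.1 p.2) ∧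
    (∀ s t, F (a + s • A) t = F a t + s • Q s t) ∧ ∀ t, Q 0 t = F' t

theorem HasVariation.congr_variation {F : Accel → ℝ → Y} {F' G' : ℝ → Y}
    (hF : HasVariation F a A F') (h : ∀ t, F' t = G' t) : HasVariation F a A G' := by
  obtain ⟨Q, hQ, hs, h0⟩ := hF
  exact ⟨Q, hQ, hs, fun t => (h0 t).trans (h t)⟩

theorem hasVariation_const (c : ℝ → Y) : HasVariation (fun _ => c) a A fun _ => 0 :=
  ⟨fun _ _ => 0, continuous_const, by simp, by simp⟩

theorem HasVariation.bilinear (b : X →L[ℝ] Y →L[ℝ] Z) {F : Accel → ℝ → X} {G : Accel → ℝ → Y}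
    {F' : ℝ → X} {G' : ℝ → Y} (hF : HasVariation F a A F') (hG : HasVariation G a A G')
    (hFc : Continuous (F a)) (hGc : Continuous (G a)) :
    HasVariation (fun a t => b (F a t) (G a t)) a A
      fun t => b (F' t) (G a t) + b (F a t) (G' t) := by
  obtain ⟨Q, hQ, hQs, hQ0⟩ := hF
  obtain ⟨R, hR, hRs, hR0⟩ := hG
  -- The exact difference quotient of a product; the last term disappears at `s = 0`.
  refine ⟨fun s t => b (Q s t) (G a t) + b (F a t) (R s t) + s • b (Q s t) (R s t), ?_,
    fun s t => ?_, fun t => by simp [hQ0, hR0]⟩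
  · have hF2 : Continuous fun p : ℝ × ℝ => F a p.2 := hFc.comp continuous_snd
    have hG2 : Continuous fun p : ℝ × ℝ => G a p.2 := hGc.comp continuous_snd
    fun_prop
  · simp only [hQs, hRs, map_add, map_smul, add_apply, smul_apply, smul_add]
    abel

theorem HasVariation.clm_mul {F G : Accel → ℝ → Y →L[ℝ] Y} {F' G' : ℝ → Y →L[ℝ] Y}
    (hF : HasVariation F a A F') (hG : HasVariation G a A G')
    (hFc : Continuous (F a)) (hGc : Continuous (G a)) :
    HasVariation (fun a t => F a t * G a t) a A fun t => F' t * G a t + F a t * G' t :=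
  HasVariation.bilinear (ContinuousLinearMap.compL ℝ Y Y Y) hF hG hFc hGc

theorem HasVariation.clm_apply {F : Accel → ℝ → Y →L[ℝ] Z} {G : Accel → ℝ → Y}
    {F' : ℝ → Y →L[ℝ] Z} {G' : ℝ → Y} (hF : HasVariation F a A F') (hG : HasVariation G a A G')
    (hFc : Continuous (F a)) (hGc : Continuous (G a)) :
    HasVariation (fun a t => F a t (G a t)) a A fun t => F' t (G a t) + F a t (G' t) :=
  HasVariation.bilinear (ContinuousLinearMap.id ℝ (Y →L[ℝ] Z)) hF hG hFc hGc

theorem HasVariation.primitive {F : Accel → ℝ → Y} {F' : ℝ → Y} (hF : HasVariation F a A F')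
    (hFc : Continuous (F a)) :
    HasVariation (fun a t => ∫ r in (0 : ℝ)..t, F a r) a A fun t => ∫ r in (0 : ℝ)..t, F' r := by
  obtain ⟨Q, hQ, hQs, hQ0⟩ := hF
  refine ⟨fun s t => ∫ r in (0 : ℝ)..t, Q s r,
    intervalIntegral.continuous_parametric_primitive_of_continuous hQ, fun s t => ?_,
    fun t => by simp [hQ0]⟩
  have hc : Continuous fun r => Q s r := hQ.comp (Continuous.prodMk_right s)
  simp only [hQs]
  rw [intervalIntegral.integral_add (hFc.intervalIntegrable _ _)
    ((hc.fun_const_smul s).intervalIntegrable _ _), intervalIntegral.integral_smul]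

theorem hasDerivAt_smul_of_continuousAt {q : ℝ → Y} (hq : ContinuousAt q 0) :
    HasDerivAt (fun s : ℝ => s • q s) (q 0) 0 := by
  rw [hasDerivAt_iff_tendsto_slope]
  refine (hq.tendsto.mono_left nhdsWithin_le_nhds).congr' ?_
  filter_upwards [self_mem_nhdsWithin] with s hs
  have hs' : s ≠ 0 := hs
  simp [slope, hs']

/-- Here the acceleration and the time vary together. Joint continuity of the quotient `Q` is what
makes this work: `s • Q s (τ + s * c)` is differentiable at `0` although `Q` need not be
differentiable. -/
theorem HasVariation.hasDerivAt_line {F : Accel → ℝ → Y} {F' : ℝ → Y} {d : Y} {τ : ℝ}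
    (hF : HasVariation F a A F') (hd : HasDerivAt (F a) d τ) (c : ℝ) :
    HasDerivAt (fun s : ℝ => F (a + s • A) (τ + s * c)) (c • d + F' τ) 0 := by
  obtain ⟨Q, hQ, hQs, hQ0⟩ := hF
  simp only [hQs]
  refine HasDerivAt.fun_add ?_ ?_
  · have hline : HasDerivAt (fun s : ℝ => τ + s * c) c 0 := by
      simpa using ((hasDerivAt_id (0 : ℝ)).mul_const c).const_add τ
    exact HasDerivAt.scomp_of_eq (0 : ℝ) hd hline (by simp)
  · have hc : Continuous fun s : ℝ => Q s (τ + s * c) :=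
      hQ.comp (by fun_prop : Continuous fun s : ℝ => (s, τ + s * c))
    have := hasDerivAt_smul_of_continuousAt hc.continuousAt
    simpa [hQ0] using this

end Variation

/-! ### The generators of the variations of the transport matrix -/

/-- The unit vector along the time axis. -/
def timeVec : Vec := Pi.single time 1

/-- The world line `z(t) = ∫_0^t Λ_4` of the origin of the frame. -/
def worldLine (a : Accel) (t : ℝ) : Vec := ∫ s in (0 : ℝ)..t, transportOp a s timeVec

/-- The boost `Λ W_A Λ⁻¹`. -/
def conjBoost (A a : Accel) (t : ℝ) : Vec →L[ℝ] Vec :=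
  transportOp a t * boostOp (A t) * transportInvOp a t

/-- The primitive of `Λ W_A Λ⁻¹`. -/
def phi (A a : Accel) (t : ℝ) : Vec →L[ℝ] Vec := ∫ s in (0 : ℝ)..t, conjBoost A a s

/-- The primitive of `Λ W_A Λ⁻¹ z`. -/
def theta (A a : Accel) (t : ℝ) : Vec := ∫ s in (0 : ℝ)..t, conjBoost A a s (worldLine a s)

theorem hasDerivAt_primitive {Y : Type*} [NormedAddCommGroup Y] [NormedSpace ℝ Y] [CompleteSpace Y]
    {f : ℝ → Y} (hf : Continuous f) (t : ℝ) :
    HasDerivAt (fun t => ∫ s in (0 : ℝ)..t, f s) (f t) t :=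
  intervalIntegral.integral_hasDerivAt_right (hf.intervalIntegrable 0 t)
    hf.aestronglyMeasurable.stronglyMeasurableAtFilter hf.continuousAt

theorem integral_eq_of_hasDerivAt {Y : Type*} [NormedAddCommGroup Y] [NormedSpace ℝ Y]
    [CompleteSpace Y] {f g : ℝ → Y} (hf : ∀ t, HasDerivAt f (g t) t) (hg : Continuous g)
    (h0 : f 0 = 0) (t : ℝ) : ∫ s in (0 : ℝ)..t, g s = f t := by
  rw [intervalIntegral.integral_eq_sub_of_hasDerivAt (fun s _ => hf s)
    (hg.intervalIntegrable 0 t), h0, sub_zero]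

section
variable (A B a : Accel)

theorem continuous_transportOp_apply (v : Vec) : Continuous fun t => transportOp a t v :=
  (continuous_transportOp a).clm_apply continuous_const

theorem hasDerivAt_worldLine (t : ℝ) : HasDerivAt (worldLine a) (transportOp a t timeVec) t :=
  hasDerivAt_primitive (continuous_transportOp_apply a timeVec) t

theorem continuous_worldLine : Continuous (worldLine a) :=
  continuous_iff_continuousAt.2 fun t => (hasDerivAt_worldLine a t).continuousAt

theorem continuous_conjBoost : Continuous (conjBoost A a) :=
  ((continuous_transportOp a).clm_comp (by fun_prop)).clm_comp (continuous_transportInvOp a)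

theorem hasDerivAt_phi (t : ℝ) : HasDerivAt (phi A a) (conjBoost A a t) t :=
  hasDerivAt_primitive (continuous_conjBoost A a) t

theorem continuous_phi : Continuous (phi A a) :=
  continuous_iff_continuousAt.2 fun t => (hasDerivAt_phi A a t).continuousAt

theorem continuous_conjBoost_worldLine : Continuous fun t => conjBoost A a t (worldLine a t) :=
  (continuous_conjBoost A a).clm_apply (continuous_worldLine a)

theorem hasDerivAt_theta (t : ℝ) : HasDerivAt (theta A a) (conjBoost A a t (worldLine a t)) t :=
  hasDerivAt_primitive (continuous_conjBoost_worldLine A a) t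

theorem continuous_theta : Continuous (theta A a) :=
  continuous_iff_continuousAt.2 fun t => (hasDerivAt_theta A a t).continuousAt

@[simp] theorem worldLine_at_zero : worldLine a 0 = 0 := by simp [worldLine]
@[simp] theorem phi_at_zero : phi A a 0 = 0 := by simp [phi]
@[simp] theorem theta_at_zero : theta A a 0 = 0 := by simp [theta]

/-- Integration by parts with `z' = Λ_4`; this is where `theta` enters the variation of the world
line. -/
theorem integral_phi_apply_transportOp (t : ℝ) :
    ∫ s in (0 : ℝ)..t, phi A a s (transportOp a s timeVec) =
      phi A a t (worldLine a t) - theta A a t := by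
  refine integral_eq_of_hasDerivAt (f := fun t => phi A a t (worldLine a t) - theta A a t)
    (fun s => ?_) ((continuous_phi A a).clm_apply (continuous_transportOp_apply a _)) (by simp) t
  refine (((hasDerivAt_phi A a s).clm_apply (hasDerivAt_worldLine a s)).fun_sub
    (hasDerivAt_theta A a s)).congr_deriv ?_
  abel

/-- In the derivative of `Λ_{a+sA} Λ_a⁻¹` the terms with `W_a` cancel and only `s W_A` survives
between the two factors. This is an exact formula in `s`, hence an explicit difference quotient. -/
theorem transportOp_add_smul_mul_inv (s t : ℝ) :
    transportOp (a + s • A) t * transportInvOp a t =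
      1 + s • ∫ r in (0 : ℝ)..t,
        transportOp (a + s • A) r * boostOp (A r) * transportInvOp a r := by
  have hc : Continuous fun r => transportOp (a + s • A) r * boostOp (A r) * transportInvOp a r :=
    ((continuous_transportOp _).clm_comp (by fun_prop)).clm_comp (continuous_transportInvOp a)
  rw [← intervalIntegral.integral_smul, integral_eq_of_hasDerivAt
    (f := fun t => transportOp (a + s • A) t * transportInvOp a t - 1) (fun r => ?_)
    (hc.fun_const_smul s) (by simp [transportOp_zero, transportInvOp_zero]) t]
  · simp
  · refine (((hasDerivAt_transportOp (a + s • A) r).fun_mul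
      (hasDerivAt_transportInvOp a r)).sub_const 1).congr_deriv ?_
    have : boostOp ((a + s • A) r) = boostOp (a r) + s • boostOp (A r) :=
      boostOp_add_smul (a r) (A r) s
    rw [this]
    ext v : 1
    simp

theorem hasVariation_transportOp :
    HasVariation transportOp a A fun t => phi A a t * transportOp a t := by
  have hc : Continuous fun p : ℝ × ℝ =>
      transportOp (a + p.1 • A) p.2 * boostOp (A p.2) * transportInvOp a p.2 :=
    ((continuous_transportOp_family a A).clm_comp (by fun_prop)).clm_comp
      ((continuous_transportInvOp a).comp continuous_snd)
  refine ⟨fun s t => (∫ r in (0 : ℝ)..t,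
      transportOp (a + s • A) r * boostOp (A r) * transportInvOp a r) * transportOp a t, ?_,
    fun s t => ?_, fun t => ?_⟩
  · have hi := intervalIntegral.continuous_parametric_primitive_of_continuous
      (f := fun s r => transportOp (a + s • A) r * boostOp (A r) * transportInvOp a r)
      (μ := MeasureTheory.volume) (a₀ := 0) hc
    exact hi.clm_comp ((continuous_transportOp a).comp continuous_snd)
  · have h := congrArg (fun T => T * transportOp a t) (transportOp_add_smul_mul_inv A a s t)
    simp only [mul_assoc, transportInvOp_mul, mul_one, add_mul, one_mul] at h
    rw [h, smul_mul_assoc]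
    rfl
  · simp [phi, conjBoost]

theorem inverse_transportOp (t : ℝ) : Ring.inverse (transportOp a t) = transportInvOp a t :=
  Ring.inverse_unit ⟨transportOp a t, transportInvOp a t, transportOp_mul_inv a t,
    transportInvOp_mul a t⟩

theorem continuous_transportInvOp_family :
    Continuous fun p : ℝ × ℝ => transportInvOp (a + p.1 • A) p.2 := by
  refine continuous_iff_continuousAt.2 fun p => ?_
  simp only [← inverse_transportOp]
  let u : (Vec →L[ℝ] Vec)ˣ := ⟨transportOp (a + p.1 • A) p.2, transportInvOp (a + p.1 • A) p.2,
    transportOp_mul_inv _ _, transportInvOp_mul _ _⟩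
  exact ContinuousAt.comp (f := fun p : ℝ × ℝ => transportOp (a + p.1 • A) p.2)
    (NormedRing.inverse_continuousAt u) (continuous_transportOp_family a A).continuousAt

/-- The quotient comes from the resolvent identity `S⁻¹ - T⁻¹ = -T⁻¹ (S - T) S⁻¹`. -/
theorem hasVariation_transportInvOp :
    HasVariation transportInvOp a A fun t => -(transportInvOp a t * phi A a t) := by
  obtain ⟨Q, hQ, hQs, hQ0⟩ := hasVariation_transportOp A a
  refine ⟨fun s t => -(transportInvOp a t * Q s t * transportInvOp (a + s • A) t), ?_,
    fun s t => ?_, fun t => ?_⟩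
  · exact ((((continuous_transportInvOp a).comp continuous_snd).clm_comp hQ).clm_comp
      (continuous_transportInvOp_family A a)).neg
  · ext v : 1
    have h := transportOp_inv_apply (a + s • A) t v
    rw [hQs] at h
    beta_reduce
    generalize transportInvOp (a + s • A) t = T at h ⊢
    have h' := congrArg (transportInvOp a t) h
    simp only [add_apply, smul_apply, map_add, map_smul, transportInvOp_transportOp_apply] at h'
    simp [← h']
  · beta_reduce
    rw [hQ0, zero_smul, add_zero, mul_assoc, mul_assoc, transportOp_mul_inv, mul_one]

theorem hasVariation_worldLine :
    HasVariation worldLine a A fun t => phi A a t (worldLine a t) - theta A a t := by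
  refine (((hasVariation_transportOp A a).clm_apply (hasVariation_const fun _ => timeVec)
    (continuous_transportOp a) continuous_const).primitive
    (continuous_transportOp_apply a _)).congr_variation fun t => ?_
  rw [← integral_phi_apply_transportOp]
  simp

/-- The middle factor `W_B` does not depend on `a`, so conjugation by `Λ` varies by the commutator
with `φ_A`. -/
theorem hasVariation_conjBoost :
    HasVariation (conjBoost B) a A
      fun t => phi A a t * conjBoost B a t - conjBoost B a t * phi A a t := by
  have hB : Continuous fun t => boostOp (B t) := by fun_prop
  have h1 := (hasVariation_transportOp A a).clm_mul (hasVariation_const fun t => boostOp (B t))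
    (continuous_transportOp a) hB
  refine (h1.clm_mul (hasVariation_transportInvOp A a)
    ((continuous_transportOp a).clm_comp hB)
    (continuous_transportInvOp a)).congr_variation fun t => ?_
  ext v : 1
  simp [conjBoost, sub_eq_add_neg]

theorem hasVariation_phi :
    HasVariation (phi B) a A fun t => ∫ s in (0 : ℝ)..t,
      (phi A a s * conjBoost B a s - conjBoost B a s * phi A a s) :=
  (hasVariation_conjBoost A B a).primitive (continuous_conjBoost B a)

theorem hasVariation_theta :
    HasVariation (theta B) a A fun t => ∫ s in (0 : ℝ)..t,
      (phi A a s (conjBoost B a s (worldLine a s)) - conjBoost B a s (theta A a s)) := by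
  refine (((hasVariation_conjBoost A B a).clm_apply (hasVariation_worldLine A a)
    (continuous_conjBoost B a) (continuous_worldLine a)).primitive
    (continuous_conjBoost_worldLine B a)).congr_variation fun t => ?_
  simp

/-- The zero-curvature identity `δ_A φ_B - δ_B φ_A = [φ_A, φ_B]`: both sides vanish at `0` and have
the same derivative by the product rule. -/
theorem integral_commutator_phi (t : ℝ) :
    (∫ s in (0 : ℝ)..t, (phi A a s * conjBoost B a s - conjBoost B a s * phi A a s)) -
      (∫ s in (0 : ℝ)..t, (phi B a s * conjBoost A a s - conjBoost A a s * phi B a s)) =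
    phi A a t * phi B a t - phi B a t * phi A a t := by
  have hc : ∀ A B, Continuous fun s => phi A a s * conjBoost B a s - conjBoost B a s * phi A a s :=
    fun A B => ((continuous_phi A a).clm_comp (continuous_conjBoost B a)).sub
      ((continuous_conjBoost B a).clm_comp (continuous_phi A a))
  rw [← intervalIntegral.integral_sub ((hc A B).intervalIntegrable _ _)
    ((hc B A).intervalIntegrable _ _)]
  refine integral_eq_of_hasDerivAt
    (f := fun t => phi A a t * phi B a t - phi B a t * phi A a t) (fun s => ?_)
    ((hc A B).sub (hc B A)) (by simp) t
  refine (((hasDerivAt_phi A a s).fun_mul (hasDerivAt_phi B a s)).fun_sub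
    ((hasDerivAt_phi B a s).fun_mul (hasDerivAt_phi A a s))).congr_deriv ?_
  simp only [Pi.sub_apply]
  abel

/-- The translation part of the same zero-curvature identity. -/
theorem integral_commutator_theta (t : ℝ) :
    (∫ s in (0 : ℝ)..t,
        (phi A a s (conjBoost B a s (worldLine a s)) - conjBoost B a s (theta A a s))) -
      (∫ s in (0 : ℝ)..t,
        (phi B a s (conjBoost A a s (worldLine a s)) - conjBoost A a s (theta B a s))) =
    phi A a t (theta B a t) - phi B a t (theta A a t) := by
  have hc : ∀ A B, Continuous fun s =>
      phi A a s (conjBoost B a s (worldLine a s)) - conjBoost B a s (theta A a s) := fun A B =>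
    ((continuous_phi A a).clm_apply (continuous_conjBoost_worldLine B a)).sub
      ((continuous_conjBoost B a).clm_apply (continuous_theta A a))
  rw [← intervalIntegral.integral_sub ((hc A B).intervalIntegrable _ _)
    ((hc B A).intervalIntegrable _ _)]
  refine integral_eq_of_hasDerivAt
    (f := fun t => phi A a t (theta B a t) - phi B a t (theta A a t)) (fun s => ?_)
    ((hc A B).sub (hc B A)) (by simp) t
  refine (((hasDerivAt_phi A a s).clm_apply (hasDerivAt_theta B a s)).fun_sub
    ((hasDerivAt_phi B a s).clm_apply (hasDerivAt_theta A a s))).congr_deriv ?_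
  simp only [Pi.sub_apply]
  abel

end

/-! ### Lifts of Poincaré transformations -/

/-- The inertial coordinates `Λ_j ξ^j + z(τ)` of the event with coordinates `x = (ξ, τ)`. -/
def position (a : Accel) (x : Vec) : Vec :=
  transportOp a (x time) (x - x time • timeVec) + worldLine a (x time)

/-- Inertial components of the lift of the infinitesimal Poincaré transformation `k ↦ M k + c` and of
the direction `A` in the space of accelerations. -/
def liftInertial (c : Vec) (M : Vec →L[ℝ] Vec) (A a : Accel) (x : Vec) : Vec :=
  (M - phi A a (x time)) (position a x) + c + theta A a (x time)

/-- Frame components of the lift of the infinitesimal Poincaré transformation `k ↦ M k + c` and of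
the direction `A` in the space of accelerations. -/
def liftFrame (c : Vec) (M : Vec →L[ℝ] Vec) (A a : Accel) (x : Vec) : Vec :=
  transportInvOp a (x time) (liftInertial c M A a x)

/-- The vector field that lifts the infinitesimal Poincaré transformation `k ↦ M k + c` and the
direction `A` in the space of accelerations. -/
def liftField (c : Vec) (M : Vec →L[ℝ] Vec) (A : Accel) : Field := fun p =>
  (liftFrame c M A p.a p.x, A)

/-- The frame components of the displacement `v` of the coordinates. -/
def frameDisplacement (a : Accel) (x v : Vec) : Vec :=
  v + ((∑ i : Fin 3, x (Sum.inl i) * a (x time) i) * v time) • timeVec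

@[simp] theorem timeVec_time : timeVec time = 1 := by simp [timeVec]

@[simp] theorem timeVec_inl (i : Fin 3) : timeVec (Sum.inl i) = 0 := by simp [timeVec]

theorem boostOp_inl (b : Fin 3 → ℝ) (v : Vec) (i : Fin 3) :
    boostOp b v (Sum.inl i) = b i * v time := boostMatrix_mulVec_inl b v i

theorem boostOp_time (b : Fin 3 → ℝ) (v : Vec) :
    boostOp b v time = ∑ i, b i * v (Sum.inl i) := boostMatrix_mulVec_time b v

theorem boostOp_spatial (b : Fin 3 → ℝ) (x : Vec) :
    boostOp b (x - x time • timeVec) = (∑ i, x (Sum.inl i) * b i) • timeVec := by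
  funext μ
  rcases μ with i | ⟨⟩
  · simp [boostOp_inl]
  · change boostOp b _ time = (_ • timeVec) time
    simp [boostOp_time, mul_comm]

theorem conjBoost_transportOp_spatial (B a : Accel) (t : ℝ) (x : Vec) :
    conjBoost B a t (transportOp a t (x - x time • timeVec)) =
      (∑ i, x (Sum.inl i) * B t i) • transportOp a t timeVec := by
  simp only [conjBoost, mul_apply_eq_comp, transportInvOp_transportOp_apply,
    boostOp_spatial, map_smul]

section
variable (c : Vec) (M : Vec →L[ℝ] Vec) (A B a : Accel) (x v : Vec)

theorem hasDerivAt_spatial_line : HasDerivAt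
    (fun s : ℝ => (x + s • v) - (x + s • v) time • timeVec) (v - v time • timeVec) 0 := by
  have h : ∀ s : ℝ, (x + s • v) - (x + s • v) time • timeVec =
      (x - x time • timeVec) + s • (v - v time • timeVec) := by
    intro s
    simp only [Pi.add_apply, Pi.smul_apply, smul_eq_mul]
    module
  simp only [h]
  simpa using ((hasDerivAt_id (0 : ℝ)).smul_const (v - v time • timeVec)).const_add
    (x - x time • timeVec)

theorem hasDerivAt_comp_line {Y : Type*} [NormedAddCommGroup Y] [NormedSpace ℝ Y]
    {F : Accel → ℝ → Y} {F' : ℝ → Y} {d : Y} (hF : HasVariation F a A F')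
    (hd : HasDerivAt (F a) d (x time)) :
    HasDerivAt (fun s : ℝ => F (a + s • A) ((x + s • v) time)) (v time • d + F' (x time)) 0 :=
  hF.hasDerivAt_line hd (v time)

/-- Since `Λ' ξ = Λ W ξ = (ξ·a) Λ_4` and `z' = Λ_4`, a change of `τ` is scaled by the lapse, which
is the frame displacement. The other terms are the motion of the frame caused by `A`. -/
theorem hasDerivAt_position_line :
    HasDerivAt (fun s : ℝ => position (a + s • A) (x + s • v))
      (transportOp a (x time) (frameDisplacement a x v) + phi A a (x time) (position a x)
        - theta A a (x time)) 0 := by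
  have h := ((hasDerivAt_comp_line A a x v (hasVariation_transportOp A a)
    (hasDerivAt_transportOp a _)).clm_apply (hasDerivAt_spatial_line x v)).fun_add
    (hasDerivAt_comp_line A a x v (hasVariation_worldLine A a) (hasDerivAt_worldLine a _))
  refine h.congr_deriv ?_
  have hb := boostOp_spatial (a (x time)) x
  simp only [zero_smul, add_zero, position, frameDisplacement, add_apply, smul_apply,
    mul_apply_eq_comp, hb]
  simp only [map_add, map_sub, map_smul]
  module

theorem hasDerivAt_liftInertial_line :
    HasDerivAt (fun s : ℝ => liftInertial c M B (a + s • A) (x + s • v))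
      ((M - phi B a (x time)) (transportOp a (x time) (frameDisplacement a x v)
          + phi A a (x time) (position a x) - theta A a (x time))
        - (v time * ∑ i, x (Sum.inl i) * B (x time) i) • transportOp a (x time) timeVec
        - (∫ s in (0 : ℝ)..x time,
            (phi A a s * conjBoost B a s - conjBoost B a s * phi A a s)) (position a x)
        + ∫ s in (0 : ℝ)..x time,
            (phi A a s (conjBoost B a s (worldLine a s)) - conjBoost B a s (theta A a s))) 0 := by
  have h := ((((hasDerivAt_comp_line A a x v (hasVariation_phi A B a)
    (hasDerivAt_phi B a _)).const_sub M).clm_apply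
    (hasDerivAt_position_line A a x v)).add_const c).fun_add
    (hasDerivAt_comp_line A a x v (hasVariation_theta A B a) (hasDerivAt_theta B a _))
  refine h.congr_deriv ?_
  have hp : conjBoost B a (x time) (position a x) =
      (∑ i, x (Sum.inl i) * B (x time) i) • transportOp a (x time) timeVec +
        conjBoost B a (x time) (worldLine a (x time)) := by
    rw [position, map_add, conjBoost_transportOp_spatial]
  simp only [zero_smul, add_zero, neg_apply, add_apply, smul_apply, hp]
  module

theorem hasDerivAt_liftFrame_line :
    HasDerivAt (fun s : ℝ => liftFrame c M B (a + s • A) (x + s • v))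
      (-(v time • boostOp (a (x time)) (liftFrame c M B a x))
        - (v time * ∑ i, x (Sum.inl i) * B (x time) i) • timeVec
        + transportInvOp a (x time)
          ((M - phi B a (x time)) (transportOp a (x time) (frameDisplacement a x v)
            + phi A a (x time) (position a x) - theta A a (x time))
          - phi A a (x time) (liftInertial c M B a x)
          - (∫ s in (0 : ℝ)..x time,
              (phi A a s * conjBoost B a s - conjBoost B a s * phi A a s)) (position a x)
          + ∫ s in (0 : ℝ)..x time,
              (phi A a s (conjBoost B a s (worldLine a s)) - conjBoost B a s (theta A a s)))) 0 := by
  have h := (hasDerivAt_comp_line A a x v (hasVariation_transportInvOp A a)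
    (hasDerivAt_transportInvOp a _)).clm_apply (hasDerivAt_liftInertial_line c M A B a x v)
  refine h.congr_deriv ?_
  simp only [zero_smul, add_zero, neg_apply, add_apply, smul_apply, map_add, map_sub, map_smul,
    mul_apply_eq_comp, liftFrame, transportInvOp_transportOp_apply, smul_neg]
  module

end

/-! ### Brackets of lifts -/

theorem continuous_lapse_line (p : FWSpace) (w : Tangent) :
    Continuous fun s : ℝ => lapse (p.val + s • w).1 (p.val + s • w).2 := by
  have h : ∀ i, Continuous fun s : ℝ => (p.val + s • w).1 i := fun i => by
    simp only [Prod.fst_add, Prod.smul_fst, Pi.add_apply, Pi.smul_apply]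
    fun_prop
  have h' : ∀ i, Continuous fun s : ℝ => (p.val + s • w).2 ((p.val + s • w).1 time) i := fun i => by
    simp only [Prod.fst_add, Prod.smul_fst, Pi.add_apply, Pi.smul_apply, Prod.snd_add,
      Prod.smul_snd, ContinuousMap.add_apply, ContinuousMap.smul_apply]
    fun_prop
  exact continuous_const.add (continuous_finsetSum _ fun i _ => (h _).mul (h' i))

theorem eventually_lapse_line_pos (p : FWSpace) (w : Tangent) :
    ∀ᶠ s : ℝ in 𝓝 0, 0 < lapse (p.val + s • w).1 (p.val + s • w).2 :=
  (continuous_lapse_line p w).continuousAt.eventually (lt_mem_nhds (by simpa using p.property))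

/-- The lapse is continuous along the line, so the extension by `0` outside the domain is not seen
near `s = 0`. -/
theorem hasDerivAlong_of_hasDerivAt {F : Type*} [NormedAddCommGroup F] [NormedSpace ℝ F]
    {f : FWSpace → F} {g : Tangent → F} {p : FWSpace} {w : Tangent} {f' : F}
    (hfg : ∀ q : FWSpace, f q = g q.val) (h : HasDerivAt (fun s : ℝ => g (p.val + s • w)) f' 0) :
    HasDerivAlong f p w f' := by
  refine h.congr_of_eventuallyEq ?_
  filter_upwards [eventually_lapse_line_pos p w] with s hs
  exact (Subtype.val_injective.extend_apply f 0 (⟨p.val + s • w, hs⟩ : FWSpace)).trans (hfg _)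

theorem frameDisplacement_toCoord (p : FWSpace) (V : Tangent) :
    frameDisplacement p.a p.x (toCoord p V).1 = V.1 := by
  have hN : lapse p.x p.a ≠ 0 := p.property.ne'
  funext μ
  rcases μ with i | ⟨⟩
  · simp [frameDisplacement, toCoord]
  · change frameDisplacement p.a p.x (toCoord p V).1 time = V.1 time
    simp only [frameDisplacement, toCoord, Pi.add_apply, Sum.elim_inr, Pi.smul_apply, timeVec_time,
      smul_eq_mul, mul_one]
    field_simp
    rw [lapse]

/-- Along a lift the terms with `φ_A` and `θ_A` cancel in the derivative of `k`, which leaves the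
Poincaré field `M' k + c'`. -/
theorem hasDerivAlong_liftFrame (c : Vec) (M : Vec →L[ℝ] Vec) (B : Accel) (p : FWSpace)
    (c' : Vec) (M' : Vec →L[ℝ] Vec) (A : Accel) :
    HasDerivAlong (fun q => (liftField c M B q).1) p (toCoord p (liftField c' M' A p))
      (-((liftFrame c' M' A p.a p.x time / lapse p.x p.a) •
          boostOp (p.a p.τ) (liftFrame c M B p.a p.x))
        - (liftFrame c' M' A p.a p.x time / lapse p.x p.a * ∑ i, p.ξ i * B p.τ i) • timeVec
        + transportInvOp p.a p.τ
          ((M - phi B p.a p.τ) (M' (position p.a p.x) + c')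
          - phi A p.a p.τ (liftInertial c M B p.a p.x)
          - (∫ s in (0 : ℝ)..p.τ, (phi A p.a s * conjBoost B p.a s
              - conjBoost B p.a s * phi A p.a s)) (position p.a p.x)
          + ∫ s in (0 : ℝ)..p.τ, (phi A p.a s (conjBoost B p.a s (worldLine p.a s))
              - conjBoost B p.a s (theta A p.a s)))) := by
  refine hasDerivAlong_of_hasDerivAt (g := fun q => liftFrame c M B q.2 q.1) (fun q => rfl) ?_
  refine (hasDerivAt_liftFrame_line c M A B p.a p.x
    (toCoord p (liftField c' M' A p)).1).congr_deriv ?_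
  have h : transportOp p.a (p.x time) (liftField c' M' A p).1 + phi A p.a (p.x time)
      (position p.a p.x) - theta A p.a (p.x time) = M' (position p.a p.x) + c' := by
    simp only [liftField, liftFrame, transportOp_inv_apply, liftInertial, sub_apply]
    abel
  rw [frameDisplacement_toCoord, h]
  rfl

theorem hasDerivAlong_liftField_snd (c : Vec) (M : Vec →L[ℝ] Vec) (B : Accel) (p : FWSpace)
    (w : Tangent) : HasDerivAlong (fun q => (liftField c M B q).2) p w 0 := by
  have hev : ∀ᶠ s : ℝ in 𝓝 0, Function.extend Subtype.val
      (fun q : FWSpace => (liftField c M B q).2) 0 (p.val + s • w) = B := by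
    filter_upwards [eventually_lapse_line_pos p w] with s hs
    exact Subtype.val_injective.extend_apply (fun q : FWSpace => (liftField c M B q).2) 0
      (⟨p.val + s • w, hs⟩ : FWSpace)
  -- The accelerations form only a topological vector space, so the derivative of the locally
  -- constant component is checked on the remainder, which vanishes near `0`.
  refine HasFDerivAtFilter.of_isLittleOTVS
    ((Asymptotics.IsLittleOTVS.zero _ _).congr' ?_ (Filter.EventuallyEq.refl _ _))
  rw [Filter.prod_pure]
  refine Filter.eventually_map.2 (hev.mono fun s hs => ?_)
  simp [hs]
  simp [liftField]

theorem frameBracket_fst_eq (p : FWSpace) (U V : Tangent) :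
    (frameBracket p U V).1 =
      (U.1 time / lapse p.x p.a) • boostOp (p.a p.τ) V.1
        - (V.1 time / lapse p.x p.a) • boostOp (p.a p.τ) U.1
        + (U.1 time / lapse p.x p.a * ∑ i, p.ξ i * V.2 p.τ i
          - V.1 time / lapse p.x p.a * ∑ i, p.ξ i * U.2 p.τ i) • timeVec := by
  funext μ
  rcases μ with i | ⟨⟩
  · simp [frameBracket, boostOp_inl]
    ring
  · change (frameBracket p U V).1 time = (_ - _ + _ • timeVec : Vec) time
    simp only [frameBracket, Pi.single_eq_same, Pi.add_apply, Pi.sub_apply, Pi.smul_apply,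
      boostOp_time, timeVec_time, smul_eq_mul, mul_one, Fin.sum_univ_three]
    ring

theorem conjBoost_zero_left (a : Accel) (t : ℝ) : conjBoost 0 a t = 0 := by
  have h : boostOp 0 = 0 := by simpa using boostOp_add_smul 0 0 1
  have h' : (0 : Accel) t = 0 := rfl
  rw [conjBoost, h', h]
  ext v : 1
  simp

@[simp] theorem phi_zero_left (a : Accel) (t : ℝ) : phi 0 a t = 0 := by
  simp [phi, conjBoost_zero_left]

@[simp] theorem theta_zero_left (a : Accel) (t : ℝ) : theta 0 a t = 0 := by
  simp [theta, conjBoost_zero_left]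

/-- The order `M' M - M M'` is that of linear vector fields, opposite to the matrix commutator. The
boost and lapse terms of the two derivatives cancel against the commutators of the frame. -/
theorem isLieBracket_liftField (c c' : Vec) (M M' : Vec →L[ℝ] Vec) (A B : Accel) :
    IsLieBracket (liftField c M A) (liftField c' M' B)
      (liftField (M' c - M c') (M' * M - M * M') 0) := by
  intro p
  refine ⟨(_, 0), (_, 0), hasDerivAlong_liftFrame c' M' B p c M A,
    hasDerivAlong_liftField_snd c' M' B p _, hasDerivAlong_liftFrame c M A p c' M' B,
    hasDerivAlong_liftField_snd c M A p _, Prod.ext ?_ ?_⟩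
  -- The second variations enter antisymmetrised, so the zero-curvature identities replace them by
  -- commutators of `φ` and `θ`.
  · have hC := congrArg (fun T : Vec →L[ℝ] Vec => T (position p.a p.x))
      (integral_commutator_phi A B p.a p.τ)
    have hT := integral_commutator_theta A B p.a p.τ
    rw [sub_apply, sub_eq_iff_eq_add] at hC
    rw [sub_eq_iff_eq_add] at hT
    simp only [Prod.fst_add, Prod.fst_sub, frameBracket_fst_eq, hC, hT]
    simp only [liftField, liftFrame, liftInertial, phi_zero_left, theta_zero_left,
      sub_apply, mul_apply_eq_comp, map_add, map_sub, FWSpace.τ, zero_apply, map_zero]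
    module
  · simp [liftField, frameBracket]

/-! ### The generators are lifts -/

theorem op_apply_single (M : Matrix Idx Idx ℝ) (μ ν : Idx) : op M (Pi.single ν 1) μ = M μ ν := by
  simp

theorem transGen_eq_liftField (μ : Idx) : transGen μ = liftField (Pi.single μ 1) 0 0 := by
  funext p
  refine Prod.ext (funext fun ν => ?_) rfl
  have h : (transGen μ p).1 ν = (transportLower p.a p.τ)ᵀ ν μ := rfl
  rw [h, transportLower, Matrix.transpose_mul, Matrix.transpose_mul, eta_transpose, ← mul_assoc]
  simp [liftField, liftFrame, liftInertial, transportInvOp, transportInv, FWSpace.τ]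

theorem apply_intervalIntegral (φ : Vec →L[ℝ] Vec) {f : ℝ → Vec} (hf : Continuous f) (ν : Idx)
    (r t : ℝ) : ∫ s in r..t, φ (f s) ν = φ (∫ s in r..t, f s) ν :=
  ((ContinuousLinearMap.proj (R := ℝ) (φ := fun _ : Idx => ℝ) ν).comp
    φ).intervalIntegral_comp_comm (hf.intervalIntegrable _ _)

theorem op_apply_spatial (M : Matrix Idx Idx ℝ) (x : Vec) (ν : Idx) :
    op M (x - x time • timeVec) ν = ∑ j : Fin 3, M ν (Sum.inl j) * x (Sum.inl j) := by
  simp [Matrix.mulVec, dotProduct]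

theorem kUpper_eq_position (p : FWSpace) : kUpper p = position p.a p.x := by
  funext β
  have h := apply_intervalIntegral (ContinuousLinearMap.id ℝ Vec)
    (continuous_transportOp_apply p.a timeVec) β 0 p.τ
  simp only [ContinuousLinearMap.id_apply] at h
  rw [position, Pi.add_apply, transportOp, op_apply_spatial, worldLine, kUpper]
  refine congrArg₂ (· + ·) rfl (Eq.trans ?_ h)
  simp [timeVec, transportOp]

/-- The infinitesimal Lorentz transformation `e_α η_β - e_β η_α`. -/
def lorentzMatrix (α β : Idx) : Matrix Idx Idx ℝ :=
  Matrix.vecMulVec (Pi.single α 1) (eta β) - Matrix.vecMulVec (Pi.single β 1) (eta α)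

theorem op_lorentzMatrix_apply (α β : Idx) (v : Vec) :
    op (lorentzMatrix α β) v =
      (eta *ᵥ v) β • (Pi.single α 1 : Vec) - (eta *ᵥ v) α • (Pi.single β 1 : Vec) := by
  simp [lorentzMatrix, Matrix.vecMulVec_mulVec]
  rfl

theorem lorentzGen_eq_liftField (α β : Idx) :
    lorentzGen α β = liftField 0 (op (lorentzMatrix α β)) 0 := by
  funext p
  have hk : ∀ γ, kLower p γ = (eta *ᵥ position p.a p.x) γ := fun γ => by
    rw [← kUpper_eq_position]
    rfl
  refine Prod.ext ?_ ?_
  · simp only [lorentzGen, transGen_eq_liftField, liftField, Prod.fst_sub, Prod.smul_fst, hk]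
    simp only [liftFrame, liftInertial, phi_zero_left, theta_zero_left, sub_zero, add_zero,
      zero_apply, zero_add, op_lorentzMatrix_apply, map_sub, map_smul]
  · simp [lorentzGen, transGen, liftField]

theorem greenLower_eq (a : Accel) (s t : ℝ) :
    greenLower a s t = (transportInv a t * transport a s)ᵀ := by
  simp only [greenLower, green, transportLower, transportInv, Matrix.transpose_mul, eta_transpose,
    Matrix.transpose_transpose]
  simp only [← mul_assoc, eta_mul_eta, one_mul]

/-- Thus `Δ` is the event seen from the frame at time `t`, which explains the two terms of its
definition. -/
theorem delta_eq (p : FWSpace) (t : ℝ) :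
    delta p t = transportInvOp p.a t (position p.a p.x - worldLine p.a t) := by
  funext ν
  have hz : position p.a p.x - worldLine p.a t =
      transportOp p.a p.τ (p.x - p.x time • timeVec)
        + ∫ s in t..p.τ, transportOp p.a s timeVec := by
    have hc := continuous_transportOp_apply p.a timeVec
    rw [← intervalIntegral.integral_interval_sub_left (hc.intervalIntegrable 0 _)
      (hc.intervalIntegrable 0 _), position, add_sub_assoc]
    rfl
  rw [hz, map_add, Pi.add_apply, ← apply_intervalIntegral _
    (continuous_transportOp_apply p.a timeVec)]
  have h : ∀ s v, transportInvOp p.a t (transportOp p.a s v) =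
      op (transportInv p.a t * transport p.a s) v := fun s v => by rw [op_mul]; rfl
  simp only [h, op_apply_spatial]
  simp only [delta, greenLower_eq, Matrix.transpose_apply, timeVec, op_apply_single]
  congr 1
  exact Finset.sum_congr rfl fun j _ => mul_comm _ _

theorem mul_eta_inl (M : Matrix Idx Idx ℝ) (μ : Idx) (i : Fin 3) :
    (M * eta) μ (Sum.inl i) = M μ (Sum.inl i) := by
  simp [eta, LieAlgebra.Orthogonal.indefiniteDiagonal]

theorem mul_eta_time (M : Matrix Idx Idx ℝ) (μ : Idx) : (M * eta) μ time = -M μ time := by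
  simp [eta, LieAlgebra.Orthogonal.indefiniteDiagonal]

/-- The antisymmetrised kernel is `-Λ W_A Δ`; the sign comes from raising the time index, `Λ^{μ4} =
-Λ^μ_4`. -/
theorem sum_mul_boostKernel (A : Accel) (p : FWSpace) (t : ℝ) (μ : Idx) :
    ∑ i, A t i * boostKernel p i t μ =
      chi t p.τ * (conjBoost A p.a t (worldLine p.a t - position p.a p.x)) μ := by
  have h : conjBoost A p.a t (worldLine p.a t - position p.a p.x) =
      -transportOp p.a t (boostOp (A t) (delta p t)) := by
    rw [delta_eq, ← neg_sub, map_neg]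
    rfl
  have hsum : ∀ v : Vec, transportOp p.a t v μ =
      ∑ i, transport p.a t μ (Sum.inl i) * v (Sum.inl i) + transport p.a t μ time * v time := by
    intro v
    simp [transportOp, Matrix.mulVec, dotProduct]
  rw [h, Pi.neg_apply, hsum]
  simp only [boostKernel, transportUpper, mul_eta_inl, mul_eta_time, boostOp_inl, boostOp_time,
    Fin.sum_univ_three]
  ring

/-- Almost everywhere `χ` is the signed indicator of the interval between `0` and `τ`. The two
endpoints are discarded, so the value of the Heaviside function at `0` is irrelevant. -/
theorem integral_chi_mul (g : ℝ → ℝ) (τ : ℝ) : ∫ t, chi t τ * g t = ∫ t in (0 : ℝ)..τ, g t := by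
  have hae : ∀ᵐ t : ℝ, t ≠ 0 ∧ t ≠ τ :=
    (MeasureTheory.Measure.ae_ne _ _).and (MeasureTheory.Measure.ae_ne _ _)
  rcases le_or_gt 0 τ with h | h
  · rw [intervalIntegral.integral_of_le h, ← MeasureTheory.integral_indicator measurableSet_Ioc]
    refine MeasureTheory.integral_congr_ae ?_
    filter_upwards [hae] with t ht
    rcases lt_or_gt_of_ne ht.1 with h1 | h1
    · have h2 : ¬ τ ≤ t := by linarith
      simp [chi, heaviside, Set.indicator, h1.not_gt, h1.not_ge, h2]
    · simp [chi, heaviside, Set.indicator, h1, h1.le, h1.not_ge, ite_mul]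
  · rw [intervalIntegral.integral_of_ge h.le, ← MeasureTheory.integral_indicator measurableSet_Ioc,
      ← MeasureTheory.integral_neg]
    refine MeasureTheory.integral_congr_ae ?_
    filter_upwards [hae] with t ht
    rcases lt_or_gt_of_ne ht.1 with h1 | h1
    · rcases lt_or_gt_of_ne ht.2 with h2 | h2
      · simp [chi, heaviside, Set.indicator, h1.le, h1.not_ge, h2.not_gt, h2.not_ge]
      · simp [chi, heaviside, Set.indicator, h1.le, h1.not_ge, h2, h2.le]
    · have h2 : ¬ t ≤ τ := by linarith
      simp [chi, heaviside, Set.indicator, h1.not_ge, h2]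

theorem integral_sum_mul_boostKernel (A : Accel) (p : FWSpace) (μ : Idx) :
    ∫ t, ∑ i, A t i * boostKernel p i t μ = liftInertial 0 0 A p.a p.x μ := by
  have hc : Continuous fun t => conjBoost A p.a t (worldLine p.a t - position p.a p.x) :=
    (continuous_conjBoost A p.a).clm_apply ((continuous_worldLine p.a).sub continuous_const)
  have h := apply_intervalIntegral (ContinuousLinearMap.id ℝ Vec) hc μ 0 p.τ
  simp only [ContinuousLinearMap.id_apply] at h
  simp only [sum_mul_boostKernel]
  rw [integral_chi_mul, h, integral_eq_of_hasDerivAt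
    (f := fun t => theta A p.a t - phi A p.a t (position p.a p.x)) (fun s => ?_) hc (by simp)]
  · simp only [liftInertial, FWSpace.τ, zero_sub, neg_apply, add_zero, Pi.sub_apply, Pi.add_apply,
      Pi.neg_apply]
    ring
  · refine ((hasDerivAt_theta A p.a s).fun_sub
      ((hasDerivAt_phi A p.a s).clm_apply (hasDerivAt_const s _))).congr_deriv ?_
    simp

theorem boostGen_eq_liftField (A : Accel) : boostGen A = liftField 0 0 A := by
  funext p
  refine Prod.ext ?_ rfl
  simp only [boostGen, integral_sum_mul_boostKernel, transGen_eq_liftField, liftField]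
  have h : ∀ μ, liftFrame (Pi.single μ 1) 0 0 p.a p.x =
      transportInvOp p.a p.τ (Pi.single μ 1) := fun μ => by
    simp [liftFrame, liftInertial, FWSpace.τ]
  simp only [h, ← map_smul, ← map_sum]
  rw [liftFrame, ← pi_eq_sum_univ' (liftInertial 0 0 A p.a p.x)]
  rfl

/-! ### Skew-symmetry with respect to the Minkowski form -/

/-- The Minkowski form. -/
def minkowski (u v : Vec) : ℝ := u ⬝ᵥ eta *ᵥ v

theorem minkowski_eq (u v : Vec) :
    minkowski u v = ∑ i : Fin 3, u (Sum.inl i) * v (Sum.inl i) - u time * v time := by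
  have h : (eta *ᵥ v) (Sum.inr ()) = -v time := eta_mulVec_time v
  simp [minkowski, dotProduct, eta_mulVec_inl, h, sub_eq_add_neg]

theorem minkowski_comm (u v : Vec) : minkowski u v = minkowski v u := by
  simp [minkowski_eq, mul_comm]

/-- Operators that are skew-symmetric with respect to the Minkowski form. -/
def IsMinkowskiSkew (T : Vec →L[ℝ] Vec) : Prop :=
  ∀ u v, minkowski (T u) v + minkowski u (T v) = 0

theorem minkowski_transportOp (a : Accel) (t : ℝ) (u v : Vec) :
    minkowski (transportOp a t u) (transportOp a t v) = minkowski u v := by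
  have h : (transport a t)ᵀ * eta * transport a t = eta := by
    have := congrArg (fun T => eta * T) (transportInv_mul a t)
    simpa only [transportInv, ← mul_assoc, eta_mul_eta, one_mul, mul_one] using this
  simp only [minkowski, transportOp, op_apply]
  rw [← Matrix.vecMul_transpose, ← Matrix.dotProduct_mulVec, Matrix.mulVec_mulVec,
    Matrix.mulVec_mulVec, h]

theorem minkowski_transportInvOp_left (a : Accel) (t : ℝ) (u v : Vec) :
    minkowski (transportInvOp a t u) v = minkowski u (transportOp a t v) := by
  rw [← minkowski_transportOp a t, transportOp_inv_apply]

theorem minkowski_transportInvOp_right (a : Accel) (t : ℝ) (u v : Vec) :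
    minkowski u (transportInvOp a t v) = minkowski (transportOp a t u) v := by
  rw [← minkowski_transportOp a t, transportOp_inv_apply]

theorem IsMinkowskiSkew.conj {T : Vec →L[ℝ] Vec} (hT : IsMinkowskiSkew T) (a : Accel) (t : ℝ) :
    IsMinkowskiSkew (transportInvOp a t * T * transportOp a t) := fun u v => by
  simp only [mul_apply_eq_comp, minkowski_transportInvOp_left, minkowski_transportInvOp_right, hT _]

theorem IsMinkowskiSkew.sub {S T : Vec →L[ℝ] Vec} (hS : IsMinkowskiSkew S)
    (hT : IsMinkowskiSkew T) : IsMinkowskiSkew (S - T) := fun u v => by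
  have h1 := hS u v
  have h2 := hT u v
  simp only [minkowski_eq, sub_apply, Pi.sub_apply, Fin.sum_univ_three] at *
  linear_combination h1 - h2

theorem isMinkowskiSkew_zero : IsMinkowskiSkew 0 := fun u v => by simp [minkowski_eq]

theorem isMinkowskiSkew_boostOp (b : Fin 3 → ℝ) : IsMinkowskiSkew (boostOp b) := fun u v => by
  simp only [minkowski_eq, boostOp_inl, boostOp_time, Fin.sum_univ_three]
  ring

theorem isMinkowskiSkew_conjBoost (A a : Accel) (t : ℝ) : IsMinkowskiSkew (conjBoost A a t) :=
  fun u v => by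
    have h := isMinkowskiSkew_boostOp (A t) (transportInvOp a t u) (transportInvOp a t v)
    rw [minkowski_transportInvOp_right, minkowski_transportInvOp_left] at h
    exact h

/-- For fixed `u` and `v` skewness is a linear condition on the operator, so it passes from the
integrand to the integral. -/
theorem isMinkowskiSkew_phi (A a : Accel) (t : ℝ) : IsMinkowskiSkew (phi A a t) := fun u v => by
  let ℓ : (Vec →L[ℝ] Vec) →ₗ[ℝ] ℝ :=
    { toFun := fun T => minkowski (T u) v + minkowski u (T v)
      map_add' := fun S T => by simp [minkowski, Matrix.mulVec_add]; ring
      map_smul' := fun s T => by simp [minkowski, Matrix.mulVec_smul]; ring }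
  have h := (LinearMap.toContinuousLinearMap ℓ).intervalIntegral_comp_comm
    ((continuous_conjBoost A a).intervalIntegrable 0 t (μ := MeasureTheory.volume))
  refine h.symm.trans ?_
  refine (intervalIntegral.integral_congr fun s _ => ?_).trans intervalIntegral.integral_zero
  exact isMinkowskiSkew_conjBoost A a s u v

theorem isMinkowskiSkew_lorentzMatrix (α β : Idx) : IsMinkowskiSkew (op (lorentzMatrix α β)) :=
  fun u v => by
    have h : ∀ γ w, minkowski (Pi.single γ 1) w = (eta *ᵥ w) γ := fun γ w => by
      rw [minkowski, single_dotProduct, one_mul]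
    rw [minkowski_comm u]
    simp only [op_lorentzMatrix_apply]
    simp only [minkowski, sub_dotProduct, smul_dotProduct] at h ⊢
    simp only [h, smul_eq_mul]
    ring

theorem minkowski_single_inl (i : Fin 3) (v : Vec) :
    minkowski (Pi.single (Sum.inl i) 1) v = v (Sum.inl i) := by
  simp [minkowski, eta_mulVec_inl]

theorem minkowski_timeVec (v : Vec) : minkowski timeVec v = -v time := by
  simp [minkowski, timeVec, eta_mulVec_time]

theorem IsMinkowskiSkew.inl_inl {T : Vec →L[ℝ] Vec} (hT : IsMinkowskiSkew T) (i j : Fin 3) :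
    T (Pi.single (Sum.inl j) 1) (Sum.inl i) = -T (Pi.single (Sum.inl i) 1) (Sum.inl j) := by
  have h := hT (Pi.single (Sum.inl j) 1) (Pi.single (Sum.inl i) 1)
  rw [minkowski_comm, minkowski_single_inl, minkowski_single_inl] at h
  linarith

theorem IsMinkowskiSkew.inl_time {T : Vec →L[ℝ] Vec} (hT : IsMinkowskiSkew T) (i : Fin 3) :
    T timeVec (Sum.inl i) = T (Pi.single (Sum.inl i) 1) time := by
  have h := hT timeVec (Pi.single (Sum.inl i) 1)
  rw [minkowski_comm, minkowski_single_inl, minkowski_timeVec] at h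
  linarith

theorem IsMinkowskiSkew.time_time {T : Vec →L[ℝ] Vec} (hT : IsMinkowskiSkew T) :
    T timeVec time = 0 := by
  have h := hT timeVec timeVec
  rw [minkowski_comm, minkowski_timeVec] at h
  linarith

/-! ### The generalised Killing equation -/

section
variable (c : Vec) (M : Vec →L[ℝ] Vec) (A a : Accel) (x : Vec)

theorem differentiableAt_comp_time {Y : Type*} [NormedAddCommGroup Y] [NormedSpace ℝ Y]
    {F : ℝ → Y} {d : Y} (h : HasDerivAt F d (x time)) :
    DifferentiableAt ℝ (fun y : Vec => F (y time)) x :=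
  DifferentiableAt.comp x (f := fun y : Vec => y time) h.differentiableAt (by fun_prop)

theorem differentiableAt_liftFrame : DifferentiableAt ℝ (liftFrame c M A a) x := by
  have h1 := differentiableAt_comp_time x (hasDerivAt_transportOp a (x time))
  have h2 := differentiableAt_comp_time x (hasDerivAt_transportInvOp a (x time))
  have h3 := differentiableAt_comp_time x (hasDerivAt_worldLine a (x time))
  have h4 := differentiableAt_comp_time x (hasDerivAt_phi A a (x time))
  have h5 := differentiableAt_comp_time x (hasDerivAt_theta A a (x time))
  have h6 : DifferentiableAt ℝ (fun y : Vec => y - y time • timeVec) x := by fun_prop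
  exact h2.clm_apply (((h4.const_sub M).clm_apply ((h1.clm_apply h6).fun_add h3)
    |>.add_const c).fun_add h5)

theorem fderiv_liftFrame_apply (v : Vec) :
    fderiv ℝ (liftFrame c M A a) x v =
      -(v time • boostOp (a (x time)) (liftFrame c M A a x))
        - (v time * ∑ i, x (Sum.inl i) * A (x time) i) • timeVec
        + (transportInvOp a (x time) * (M - phi A a (x time)) * transportOp a (x time))
          (frameDisplacement a x v) := by
  -- At fixed acceleration the direction of variation is `0`, which removes all variation terms.
  have h := hasDerivAt_liftFrame_line c M 0 A a x v
  have hline : HasDerivAt (fun s : ℝ => x + s • v) v 0 := by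
    simpa using ((hasDerivAt_id (0 : ℝ)).smul_const v).const_add x
  have h' := (differentiableAt_liftFrame c M A a x).hasFDerivAt.comp_hasDerivAt_of_eq (0 : ℝ) hline
    (by simp)
  simp only [smul_zero, add_zero] at h
  rw [h'.unique h]
  simp

theorem frameDisplacement_single_inl (i : Fin 3) :
    frameDisplacement a x (Pi.single (Sum.inl i) 1) = Pi.single (Sum.inl i) 1 := by
  simp [frameDisplacement]

theorem frameDisplacement_single_time :
    frameDisplacement a x (Pi.single time 1) = lapse x a • timeVec := by
  simp [frameDisplacement, lapse, timeVec, add_smul]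

variable {a} in
theorem hasFDerivAt_lapse (ha : DifferentiableAt ℝ a (x time)) :
    ∃ D : Vec →L[ℝ] ℝ, HasFDerivAt (fun y => lapse y a) D x ∧
      (∀ i, D (Pi.single (Sum.inl i) 1) = a (x time) i) ∧
      D (Pi.single time 1) = ∑ i : Fin 3, x (Sum.inl i) * deriv a (x time) i := by
  have hc : ∀ i, HasFDerivAt (fun y : Vec => y i) (ContinuousLinearMap.proj (R := ℝ) i) x :=
    fun i => hasFDerivAt_apply i x
  have hai : ∀ i, HasFDerivAt (fun y : Vec => a (y time) i)
      (deriv a (x time) i • ContinuousLinearMap.proj (R := ℝ) time) x := fun i =>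
    HasDerivAt.comp_hasFDerivAt (h₂ := fun t => a t i) x (hasDerivAt_pi.1 ha.hasDerivAt i) (hc time)
  refine ⟨_, (HasFDerivAt.fun_sum fun i _ => (hc (Sum.inl i)).mul (hai i)).const_add 1, ?_, ?_⟩
  · intro i
    simp [Pi.single_apply]
  · simp

theorem atAccel_eventuallyEq (ha : DifferentiableAt ℝ a (x time)) (hx : 0 < lapse x a) :
    (liftField c M A).atAccel a =ᶠ[𝓝 x] fun y => Sum.elim
      (fun i => liftFrame c M A a y (Sum.inl i)) (fun _ => liftFrame c M A a y time / lapse y a) := by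
  obtain ⟨D, hD, -⟩ := hasFDerivAt_lapse x ha
  filter_upwards [hD.continuousAt.eventually (lt_mem_nhds hx)] with y hy
  exact Subtype.val_injective.extend_apply
    (fun q : FWSpace => (toCoord q (liftField c M A q)).1) 0 (⟨(y, a), hy⟩ : FWSpace)

theorem hasFDerivAt_atAccel {D : Vec →L[ℝ] ℝ} (ha : DifferentiableAt ℝ a (x time))
    (hx : 0 < lapse x a) (hD : HasFDerivAt (fun y => lapse y a) D x) :
    DifferentiableAt ℝ ((liftField c M A).atAccel a) x ∧ ∀ v,
      (∀ i, fderiv ℝ ((liftField c M A).atAccel a) x v (Sum.inl i) =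
        fderiv ℝ (liftFrame c M A a) x v (Sum.inl i)) ∧
      fderiv ℝ ((liftField c M A).atAccel a) x v time =
        (fderiv ℝ (liftFrame c M A a) x v time * lapse x a - liftFrame c M A a x time * D v) /
          lapse x a ^ 2 := by
  have hV := hasFDerivAt_pi'.1 (differentiableAt_liftFrame c M A a x).hasFDerivAt
  have hT := (hV time).mul ((hasDerivAt_inv hx.ne').comp_hasFDerivAt x hD)
  let X' : Vec →L[ℝ] Vec := ContinuousLinearMap.pi (Sum.elim
    (fun i => (ContinuousLinearMap.proj (Sum.inl i)).comp (fderiv ℝ (liftFrame c M A a) x))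
    (fun _ => (lapse x a ^ 2)⁻¹ • (lapse x a • (ContinuousLinearMap.proj time).comp
      (fderiv ℝ (liftFrame c M A a) x) - liftFrame c M A a x time • D)))
  have h : HasFDerivAt ((liftField c M A).atAccel a) X' x := by
    refine HasFDerivAt.congr_of_eventuallyEq ?_ (atAccel_eventuallyEq c M A a x ha hx)
    refine hasFDerivAt_pi'.2 fun μ => ?_
    rcases μ with i | ⟨⟩
    · exact hV (Sum.inl i)
    · refine hT.congr_fderiv ?_
      ext v
      simp [X']
      field_simp
      ring
  refine ⟨h.differentiableAt, fun v => ?_⟩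
  rw [h.fderiv]
  refine ⟨fun i => rfl, ?_⟩
  simp [X', div_eq_inv_mul, mul_comm]

theorem metric_inl_left (v : Fin 3 → ℝ) (i : Fin 3) (ν : Idx) :
    metric x v (Sum.inl i) ν = if Sum.inl i = ν then 1 else 0 := by
  rcases ν with j | ⟨⟩ <;> simp [metric, Matrix.diagonal_apply]

theorem metric_inl_right (v : Fin 3 → ℝ) (i : Fin 3) (μ : Idx) :
    metric x v μ (Sum.inl i) = if μ = Sum.inl i then 1 else 0 := by
  rcases μ with j | ⟨⟩ <;> simp [metric, Matrix.diagonal_apply]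

theorem sum_mul_metric_inl (v : Fin 3 → ℝ) (f : Idx → ℝ) (i : Fin 3) :
    ∑ α, f α * metric x v α (Sum.inl i) = f (Sum.inl i) := by
  simp [metric, Matrix.diagonal_apply]

theorem sum_mul_metric_time (f : Idx → ℝ) :
    ∑ α, f α * metric x (a (x time)) α time = -(f time * lapse x a ^ 2) := by
  simp [metric, Matrix.diagonal_apply, lapse]

/-- The boost term of the frame derivative cancels the derivatives of the lapse in `ξ`, and the term
`-ξ·A` cancels the explicit variation of the metric with `a`. The quotient rule for `V^4 / N`, with
`N` the lapse, absorbs the time derivative of `N`. What is left is a skew operator, whose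
symmetrised part is zero. -/
theorem isInfinitesimalGeneralisedIsometry_liftField (ha : Differentiable ℝ a)
    (hM : IsMinkowskiSkew M) :
    IsInfinitesimalGeneralisedIsometry a ((liftField c M A).atAccel a) A := by
  intro x hx
  obtain ⟨D, hD, hDi, hDt⟩ := hasFDerivAt_lapse x (ha (x time))
  obtain ⟨hX, hX'⟩ := hasFDerivAt_atAccel c M A a x (ha _) hx hD
  refine ⟨hX, ?_⟩
  have hm := (hM.sub (isMinkowskiSkew_phi A a (x time))).conj a (x time)
  have hfd := fderiv_liftFrame_apply c M A a x
  have hval : (liftField c M A).atAccel a x = Sum.elim (fun i => liftFrame c M A a x (Sum.inl i))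
      (fun _ => liftFrame c M A a x time / lapse x a) :=
    (atAccel_eventuallyEq c M A a x (ha _) hx).self_of_nhds
  have hN : lapse x a ≠ 0 := hx.ne'
  have hg : ∀ v, fderiv ℝ (fun y : Vec => metric y (a (y time)) time time) x v =
      -(2 * lapse x a * D v) := by
    intro v
    have h : (fun y : Vec => metric y (a (y time)) time time) = fun y => -(lapse y a) ^ 2 := by
      funext y
      simp [metric, lapse]
    rw [h, (hD.pow 2).fun_neg.fderiv]
    simp
  have hg' : ∀ i, fderiv ℝ (fun v => metric x v time time) (a (x time)) (Pi.single i 1) =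
      -(2 * lapse x a * x (Sum.inl i)) := by
    intro i
    have h : (fun v => metric x v time time) =
        fun v : Fin 3 → ℝ => -(1 + ∑ i : Fin 3, x (Sum.inl i) * v i) ^ 2 := by
      funext y
      simp [metric]
    have hs : HasFDerivAt (fun v : Fin 3 → ℝ => ∑ i : Fin 3, x (Sum.inl i) * v i)
        (∑ i, x (Sum.inl i) • ContinuousLinearMap.proj i) (a (x time)) :=
      HasFDerivAt.fun_sum fun i _ => HasFDerivAt.const_mul
        (hasFDerivAt_apply (𝕜 := ℝ) (F' := fun _ : Fin 3 => ℝ) i (a (x time))) (x (Sum.inl i))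
    rw [h, ((hs.const_add 1).pow 2).fun_neg.fderiv]
    simp only [neg_apply, smul_apply, sum_apply, ContinuousLinearMap.proj_apply, lapse,
      Pi.single_apply, smul_eq_mul, mul_ite, mul_one, mul_zero, Finset.sum_ite_eq',
      Finset.mem_univ, if_true, nsmul_eq_mul]
    norm_num
  -- From here on only the skewness of this operator matters.
  generalize transportInvOp a (x time) * (M - phi A a (x time)) * transportOp a (x time) = T
    at hm hfd
  have hVi : ∀ i, fderiv ℝ (liftFrame c M A a) x (Pi.single (Sum.inl i) 1) =
      T (Pi.single (Sum.inl i) 1) := fun i => by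
    simp [hfd, frameDisplacement_single_inl]
  have hVti : ∀ i, fderiv ℝ (liftFrame c M A a) x (Pi.single time 1) (Sum.inl i) =
      -(a (x time) i * liftFrame c M A a x time) +
        lapse x a * T (Pi.single (Sum.inl i) 1) time := fun i => by
    simp [hfd, frameDisplacement_single_time, boostOp_inl, hm.inl_time]
  have hVtt : fderiv ℝ (liftFrame c M A a) x (Pi.single time 1) time =
      -(∑ i, a (x time) i * liftFrame c M A a x (Sum.inl i)) -
        ∑ i, x (Sum.inl i) * A (x time) i := by
    simp [hfd, frameDisplacement_single_time, boostOp_time, hm.time_time]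
  have hit : ∀ i, ∑ α, (liftField c M A).atAccel a x α *
        fderiv ℝ (fun y => metric y (a (y time)) (Sum.inl i) time) x (Pi.single α 1)
      + ∑ α, fderiv ℝ ((liftField c M A).atAccel a) x (Pi.single time 1) α *
        metric x (a (x time)) α (Sum.inl i)
      + ∑ α, fderiv ℝ ((liftField c M A).atAccel a) x (Pi.single (Sum.inl i) 1) α *
        metric x (a (x time)) α time
      + ∑ k : Fin 3, A (x time) k *
        fderiv ℝ (fun v => metric x v (Sum.inl i) time) (a (x time)) (Pi.single k 1) = 0 := by
    intro i
    simp only [metric_inl_left, sum_mul_metric_inl, sum_mul_metric_time, (hX' _).1, (hX' _).2,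
      hVi, hVti, hDi]
    simp
    field_simp
    ring
  rintro (i | ⟨⟩) (j | ⟨⟩)
  · simp only [metric_inl_left, sum_mul_metric_inl, (hX' _).1, hVi]
    simp [hm.inl_inl i j]
  · exact hit i
  · refine Eq.trans ?_ (hit j)
    simp only [metric_inl_left, metric_inl_right]
    simp
    ring
  · change ∑ α, (liftField c M A).atAccel a x α *
        fderiv ℝ (fun y => metric y (a (y time)) time time) x (Pi.single α 1)
      + ∑ α, fderiv ℝ ((liftField c M A).atAccel a) x (Pi.single time 1) α *
        metric x (a (x time)) α time
      + ∑ α, fderiv ℝ ((liftField c M A).atAccel a) x (Pi.single time 1) α *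
        metric x (a (x time)) α time
      + ∑ k : Fin 3, A (x time) k *
        fderiv ℝ (fun v => metric x v time time) (a (x time)) (Pi.single k 1) = 0
    have hsum : ∀ f : Idx → ℝ, ∑ α, f α = ∑ i : Fin 3, f (Sum.inl i) + f time := by simp
    simp only [sum_mul_metric_time, hg, hg', (hX' _).2, hVtt]
    simp only [hsum, hval, hDt, hDi, Sum.elim_inl, Sum.elim_inr, Fin.sum_univ_three]
    field_simp
    ring

end

/-! ### The Lie algebra of the generators -/

section
variable (A B a : Accel) (t : ℝ)

theorem conjBoost_add_smul (s : ℝ) :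
    conjBoost (A + s • B) a t = conjBoost A a t + s • conjBoost B a t := by
  have h : boostOp ((A + s • B) t) = boostOp (A t) + s • boostOp (B t) :=
    boostOp_add_smul (A t) (B t) s
  rw [conjBoost, h]
  ext v : 1
  simp [conjBoost]

theorem phi_add_smul (s : ℝ) : phi (A + s • B) a t = phi A a t + s • phi B a t := by
  have hA := (continuous_conjBoost A a).intervalIntegrable 0 t (μ := MeasureTheory.volume)
  have hB := ((continuous_conjBoost B a).fun_const_smul s).intervalIntegrable 0 t
    (μ := MeasureTheory.volume)
  simp only [phi, conjBoost_add_smul]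
  rw [intervalIntegral.integral_add hA hB, intervalIntegral.integral_smul]

theorem theta_add_smul (s : ℝ) : theta (A + s • B) a t = theta A a t + s • theta B a t := by
  have hA := (continuous_conjBoost_worldLine A a).intervalIntegrable 0 t
    (μ := MeasureTheory.volume)
  have hB := ((continuous_conjBoost_worldLine B a).fun_const_smul s).intervalIntegrable 0 t
    (μ := MeasureTheory.volume)
  simp only [theta, conjBoost_add_smul, add_apply, smul_apply]
  rw [intervalIntegral.integral_add hA hB, intervalIntegral.integral_smul]

end

theorem liftField_add_smul (c c' : Vec) (M M' : Vec →L[ℝ] Vec) (A B : Accel) (s : ℝ) :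
    liftField (c + s • c') (M + s • M') (A + s • B) = liftField c M A + s • liftField c' M' B := by
  funext p
  refine Prod.ext ?_ rfl
  change liftFrame _ _ _ p.a p.x = liftFrame _ _ _ p.a p.x + s • liftFrame _ _ _ p.a p.x
  simp only [liftFrame, ← map_smul, ← map_add]
  congr 1
  simp only [liftInertial, phi_add_smul, theta_add_smul, sub_apply, add_apply, smul_apply]
  module

/-- The linear map that sends an infinitesimal Poincaré transformation and a direction in the
space of accelerations to their lift. -/
def liftLinear : Vec × (Vec →L[ℝ] Vec) × Accel →ₗ[ℝ] Field where
  toFun u := liftField u.1 u.2.1 u.2.2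
  map_add' u v := by
    simpa using liftField_add_smul u.1 v.1 u.2.1 v.2.1 u.2.2 v.2.2 1
  map_smul' s u := by
    have h0 : liftField 0 0 0 = 0 := by
      funext p
      refine Prod.ext ?_ rfl
      simp [liftField, liftFrame, liftInertial]
    simpa [h0] using liftField_add_smul 0 u.1 0 u.2.1 0 u.2.2 s

theorem lorentz_transpose (N : Lorentz) : (N : Matrix Idx Idx ℝ)ᵀ * eta = -(eta * N.1) := by
  have h := (mem_skewAdjointMatricesLieSubalgebra _ _).1 N.2
  rw [mem_skewAdjointMatricesSubmodule] at h
  exact (h : _ᵀ * eta = eta * (-_)).trans (mul_neg _ _)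

theorem lorentzMatrix_mem (α β : Idx) :
    lorentzMatrix α β ∈ LieAlgebra.Orthogonal.so' (Fin 3) Unit ℝ := by
  refine (mem_skewAdjointMatricesLieSubalgebra _ _).2 ?_
  rw [mem_skewAdjointMatricesSubmodule]
  change (lorentzMatrix α β)ᵀ * eta = eta * (-lorentzMatrix α β)
  have h : ∀ γ ν, eta γ ν = eta ν γ := fun γ ν => congrFun (congrFun eta_transpose ν) γ
  ext μ ν
  simp [lorentzMatrix, sub_mul, mul_sub, Matrix.mul_apply, Matrix.vecMulVec_apply, Pi.single_apply]
  rw [h μ, h μ]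

/-- As `N η` is antisymmetric, each pair of indices is counted twice, whence the factor `2`. It
follows that the matrices of the `J_{αβ}` span the Lorentz algebra. -/
theorem sum_smul_lorentzMatrix (N : Lorentz) :
    ∑ α, ∑ β, (N.1 * eta) α β • lorentzMatrix α β = (2 : ℝ) • N.1 := by
  have h1 : (N.1 * eta)ᵀ = -(N.1 * eta) := by
    have h := congrArg (fun T => eta * T * eta) (lorentz_transpose N)
    simp only [mul_assoc, eta_mul_eta, mul_one, mul_neg, neg_mul] at h
    rw [← mul_assoc, ← mul_assoc, eta_mul_eta, one_mul] at h
    rw [Matrix.transpose_mul, eta_transpose, h]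
  have h2 : N.1 = N.1 * eta * eta := by rw [mul_assoc, eta_mul_eta, mul_one]
  have h3 : (N.1 * eta)ᵀ * eta = -N.1 := by rw [h1, neg_mul, ← h2]
  ext μ ν
  have h4 := congrFun (congrFun h2 μ) ν
  have h5 := congrFun (congrFun h3 μ) ν
  rw [Matrix.mul_apply] at h4 h5
  simp only [Matrix.sum_apply, Matrix.smul_apply, lorentzMatrix, Matrix.sub_apply,
    Matrix.vecMulVec_apply, Pi.single_apply, smul_eq_mul, mul_sub, Finset.sum_sub_distrib]
  simp at h4 h5 ⊢
  linarith

/-- The lift of the Poincaré algebra and of the directions in the space of accelerations. -/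
def liftPoincare : Accel × Poincare →ₗ[ℝ] Field :=
  liftLinear ∘ₗ
    { toFun := fun u => (u.2.left, -op u.2.right.1, u.1)
      map_add' := fun u v => by simp [add_comm]
      map_smul' := fun s u => by simp }

theorem liftPoincare_apply (u : Accel × Poincare) :
    liftPoincare u = liftField u.2.left (-op u.2.right.1) u.1 := rfl

/-- The sign in `-op` compensates the reversed commutator of linear vector fields, so the lift
respects brackets and not only reversed ones. -/
theorem isLieBracket_liftPoincare (u v : Accel × Poincare) :
    IsLieBracket (liftPoincare u) (liftPoincare v) (liftPoincare ⁅u, v⁆) := by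
  have h : liftPoincare ⁅u, v⁆ = liftField (-op v.2.right.1 u.2.left - -op u.2.right.1 v.2.left)
      (-op v.2.right.1 * -op u.2.right.1 - -op u.2.right.1 * -op v.2.right.1) 0 := by
    rw [liftPoincare_apply]
    congr 1
    · change 0 + u.2.right.1 *ᵥ v.2.left - v.2.right.1 *ᵥ u.2.left = _
      simp
      abel
    · change -op ⁅u.2.right.1, v.2.right.1⁆ = _
      rw [LieRing.of_associative_ring_bracket, map_sub, op_mul, op_mul]
      ext w : 1
      simp [Matrix.mulVec_neg]
  rw [h]
  exact isLieBracket_liftField u.2.left v.2.left (-op u.2.right.1) (-op v.2.right.1) u.1 v.1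

theorem position_zero (x : Vec) : position 0 x = x := by
  have h : ∀ t, transportOp 0 t = 1 := fun t => by
    refine (eq_transportOp_of_hasDerivAt 0 (L := fun _ => 1) rfl (fun s => ?_) t).symm
    refine (hasDerivAt_const s _).congr_deriv ?_
    have h : boostOp 0 = 0 := by simpa using boostOp_add_smul 0 0 1
    have h' : (0 : Accel) s = 0 := rfl
    rw [h', h, mul_zero]
  simp [position, worldLine, h]

/-- The direction `A` is read off the second component. At `a = 0` the lapse is `1` and the
coordinates are inertial, so the affine field is visible on all of `ℝ⁴`; its value at the origin
gives the translation, and then the linear part follows. -/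
theorem liftPoincare_injective : Function.Injective liftPoincare := by
  refine (injective_iff_map_eq_zero _).2 fun u hu => ?_
  have hA : u.1 = 0 := by
    have hp : 0 < lapse 0 0 := by simp [lapse]
    exact congrArg Prod.snd (congrFun hu ⟨(0, 0), hp⟩)
  have hx : ∀ x : Vec, -(u.2.right.1 *ᵥ x) + u.2.left = 0 := by
    intro x
    have hp : 0 < lapse x 0 := by simp [lapse]
    have h : liftFrame u.2.left (-op u.2.right.1) u.1 0 x = 0 :=
      congrArg Prod.fst (congrFun hu ⟨(x, 0), hp⟩)
    have h' := congrArg (transportOp 0 (x time)) h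
    simpa [liftFrame, liftInertial, hA, position_zero] using h'
  have hc : u.2.left = 0 := by simpa using hx 0
  have hN : u.2.right = 0 := by
    refine Subtype.ext (op_injective ?_)
    ext x : 1
    simpa [hc] using hx x
  exact Prod.ext hA (LieAlgebra.SemiDirectSum.ext hc hN)

theorem range_liftPoincare : LinearMap.range liftPoincare = generatorSpan := by
  refine le_antisymm ?_ (Submodule.span_le.2 ?_)
  · rintro _ ⟨u, rfl⟩
    have h1 : liftPoincare u = liftLinear (u.2.left, 0, 0) + liftLinear (0, -op u.2.right.1, 0)
        + liftLinear (0, 0, u.1) := by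
      rw [← map_add, ← map_add, liftPoincare_apply]
      simp [liftLinear]
    have hP : liftLinear (u.2.left, 0, 0) ∈ generatorSpan := by
      let P : Vec →ₗ[ℝ] Field := liftLinear ∘ₗ LinearMap.inl ℝ _ _
      have h : liftLinear (u.2.left, 0, 0) = P (∑ μ, u.2.left μ • Pi.single μ 1) := by
        rw [← pi_eq_sum_univ' u.2.left]
        rfl
      rw [h, map_sum]
      refine Submodule.sum_mem _ fun μ _ => ?_
      rw [map_smul]
      exact Submodule.smul_mem _ _ (Submodule.subset_span
        (Or.inl (Or.inl ⟨μ, transGen_eq_liftField μ⟩)))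
    have hJ : liftLinear (0, -op u.2.right.1, 0) ∈ generatorSpan := by
      have hN : u.2.right.1 = (2⁻¹ : ℝ) • ∑ α, ∑ β,
          (u.2.right.1 * eta) α β • lorentzMatrix α β := by
        rw [sum_smul_lorentzMatrix, smul_smul]
        norm_num
      let J : Matrix Idx Idx ℝ →ₗ[ℝ] Field :=
        liftLinear ∘ₗ LinearMap.inr ℝ _ _ ∘ₗ LinearMap.inl ℝ _ _ ∘ₗ op
      have hJ : ∀ α β, J (lorentzMatrix α β) ∈ generatorSpan := fun α β =>
        Submodule.subset_span (Or.inl (Or.inr ⟨(α, β), lorentzGen_eq_liftField α β⟩))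
      have h : liftLinear (0, -op u.2.right.1, 0) = -J u.2.right.1 := by
        rw [← map_neg, ← map_neg]
        rfl
      rw [h, hN, map_smul]
      simp only [map_sum, map_smul]
      exact Submodule.neg_mem _ (Submodule.smul_mem _ _ (Submodule.sum_mem _ fun α _ =>
        Submodule.sum_mem _ fun β _ => Submodule.smul_mem _ _ (hJ α β)))
    rw [h1]
    refine Submodule.add_mem _ (Submodule.add_mem _ hP hJ)
      (Submodule.subset_span (Or.inr ⟨u.1, ?_⟩))
    exact boostGen_eq_liftField _
  · rintro _ ((⟨μ, rfl⟩ | ⟨⟨α, β⟩, rfl⟩) | ⟨A, rfl⟩)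
    · refine ⟨(0, ⟨Pi.single μ 1, 0⟩), ?_⟩
      simp [liftPoincare_apply, transGen_eq_liftField]
    · refine ⟨(0, ⟨0, -⟨lorentzMatrix α β, lorentzMatrix_mem α β⟩⟩), ?_⟩
      simp [liftPoincare_apply, lorentzGen_eq_liftField]
    · refine ⟨(A, 0), ?_⟩
      simp [liftPoincare_apply, boostGen_eq_liftField]

theorem not_finiteDimensional_accel : ¬ FiniteDimensional ℝ Accel := by
  intro h
  -- Polynomials, repeated in the three components, embed into the accelerations.
  let f : Polynomial ℝ →ₗ[ℝ] Accel :=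
    { toFun := fun q => ⟨fun t _ => q.eval t, by fun_prop⟩
      map_add' := fun q r => by ext; simp
      map_smul' := fun s q => by ext; simp }
  have hf : Function.Injective f := fun q r hqr => Polynomial.funext fun t =>
    congrFun (congrArg (fun g : Accel => g t) hqr) 0
  have := FiniteDimensional.of_injective f hf
  exact Polynomial.not_finite this

/-- The Lie algebra of the generators as an extension of the Poincaré algebra. -/
def generatorExtension : LieAlgebra.Extension.{0, 0, 0, 0} ℝ Accel Poincare where
  L := Accel × Poincare
  instLieRing := inferInstance
  instLieAlgebra := inferInstance
  incl := LieHom.inl ℝ Accel Poincare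
  proj := LieHom.snd ℝ Accel Poincare
  IsExtension :=
    { ker_eq_bot := (LieHom.ker_eq_bot _).2 fun A B h => congrArg Prod.fst h
      range_eq_top := (LieHom.range_eq_top _).2 LieHom.snd_surjective
      exact := by
        refine (LieHom.range_eq_ker_iff _ _).2 fun u => ⟨fun h => ⟨u.1, ?_⟩, ?_⟩
        · exact Prod.ext rfl h.symm
        · rintro ⟨A, rfl⟩
          rfl }

/-! ### The commutation relations of the generators. -/

theorem isLieBracket_transGen_transGen (μ ν : Idx) :
    IsLieBracket (transGen μ) (transGen ν) 0 := by
  have h := isLieBracket_liftField (Pi.single μ 1) (Pi.single ν 1) 0 0 0 0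
  rw [← transGen_eq_liftField, ← transGen_eq_liftField] at h
  convert h using 1
  exact (map_zero liftLinear).symm.trans (by simp [liftLinear])

/-- The Poincaré part of `D_A` is zero, so `D_A` commutes with every lift; this covers all three
relations for `D_A`. -/
theorem isLieBracket_boostGen_liftField (A : Accel) (c : Vec) (M : Vec →L[ℝ] Vec) (B : Accel) :
    IsLieBracket (boostGen A) (liftField c M B) 0 := by
  have h := isLieBracket_liftField 0 c 0 M A B
  rw [← boostGen_eq_liftField] at h
  convert h using 1
  exact (map_zero liftLinear).symm.trans (by simp [liftLinear])

theorem isLieBracket_lorentzGen_transGen (α β μ : Idx) :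
    IsLieBracket (lorentzGen α β) (transGen μ) (eta μ α • transGen β - eta μ β • transGen α) := by
  have h := isLieBracket_liftField 0 (Pi.single μ 1) (op (lorentzMatrix α β)) 0 0 0
  rw [← transGen_eq_liftField, ← lorentzGen_eq_liftField] at h
  convert h using 1
  simp only [transGen_eq_liftField]
  change eta μ α • liftLinear (Pi.single β 1, 0, 0) - eta μ β • liftLinear (Pi.single α 1, 0, 0) =
    liftLinear (_, _, 0)
  rw [← map_smul, ← map_smul, ← map_sub]
  have hs : ∀ γ, eta γ μ = eta μ γ := fun γ => congrFun (congrFun eta_transpose μ) γ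
  congr 1
  refine Prod.ext ?_ (by simp; rfl)
  simp [op_lorentzMatrix_apply, -op_apply, hs]

/-- The product with `α β` on the right comes first, as in the bracket of the corresponding vector
fields. -/
theorem lorentzMatrix_commutator (α β μ ν : Idx) :
    lorentzMatrix μ ν * lorentzMatrix α β - lorentzMatrix α β * lorentzMatrix μ ν =
      (eta μ α • lorentzMatrix β ν - eta μ β • lorentzMatrix α ν)
        - (eta ν α • lorentzMatrix β μ - eta ν β • lorentzMatrix α μ) := by
  have hs : ∀ γ δ, eta γ δ = eta δ γ := fun γ δ => congrFun (congrFun eta_transpose δ) γ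
  refine op_injective ?_
  ext v : 1
  simp only [map_sub, map_smul, op_mul, mul_apply_eq_comp, sub_apply, smul_apply,
    op_lorentzMatrix_apply, Matrix.mulVec_single_one, Matrix.col_apply]
  rw [hs α μ, hs α ν, hs β μ, hs β ν]
  module

theorem isLieBracket_lorentzGen_lorentzGen (α β μ ν : Idx) :
    IsLieBracket (lorentzGen α β) (lorentzGen μ ν)
      ((eta μ α • lorentzGen β ν - eta μ β • lorentzGen α ν)
        - (eta ν α • lorentzGen β μ - eta ν β • lorentzGen α μ)) := by
  have h := isLieBracket_liftField 0 0 (op (lorentzMatrix α β)) (op (lorentzMatrix μ ν)) 0 0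
  rw [← lorentzGen_eq_liftField, ← lorentzGen_eq_liftField, ← op_mul, ← op_mul, ← map_sub,
    lorentzMatrix_commutator] at h
  convert h using 1
  simp only [lorentzGen_eq_liftField]
  let J : Matrix Idx Idx ℝ →ₗ[ℝ] Field :=
    liftLinear ∘ₗ LinearMap.inr ℝ _ _ ∘ₗ LinearMap.inl ℝ _ _ ∘ₗ op
  have hJ : ∀ N, liftField 0 (op N) 0 = J N := fun _ => rfl
  rw [map_zero, map_zero, sub_zero]
  simp only [hJ]
  simp only [map_sub, map_smul]

end FermiWalker

end

open FermiWalker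
theorem mainTheorem1 :
    -- the generators are infinitesimal generalised isometries
    (∀ a : Accel, Differentiable ℝ a →
      (∀ μ, IsInfinitesimalGeneralisedIsometry a ((transGen μ).atAccel a) 0) ∧
      (∀ α β, IsInfinitesimalGeneralisedIsometry a ((lorentzGen α β).atAccel a) 0) ∧
      (∀ A : Accel, IsInfinitesimalGeneralisedIsometry a ((boostGen A).atAccel a) A)) ∧
    -- the commutation relations
    (∀ μ ν, IsLieBracket (transGen μ) (transGen ν) 0) ∧
    (∀ α β μ, IsLieBracket (lorentzGen α β) (transGen μ)
      (eta μ α • transGen β - eta μ β • transGen α)) ∧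
    (∀ α β μ ν, IsLieBracket (lorentzGen α β) (lorentzGen μ ν)
      ((eta μ α • lorentzGen β ν - eta μ β • lorentzGen α ν)
        - (eta ν α • lorentzGen β μ - eta ν β • lorentzGen α μ))) ∧
    (∀ (A : Accel) (μ : Idx), IsLieBracket (boostGen A) (transGen μ) 0) ∧
    (∀ (A : Accel) (α β : Idx), IsLieBracket (boostGen A) (lorentzGen α β) 0) ∧
    (∀ A B : Accel, IsLieBracket (boostGen A) (boostGen B) 0) ∧
    -- the generators span a Lie algebra of vector fields, which is an extension of the Poincaré
    -- algebra by the infinite-dimensional abelian Lie algebra of the `D_A`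
    IsLieAbelian Accel ∧ ¬ FiniteDimensional ℝ Accel ∧
    ∃ (E : LieAlgebra.Extension.{0, 0, 0, 0} ℝ Accel Poincare) (ρ : E.L →ₗ[ℝ] Field),
      Function.Injective ρ ∧ LinearMap.range ρ = generatorSpan ∧
      (∀ u v : E.L, IsLieBracket (ρ u) (ρ v) (ρ ⁅u, v⁆)) ∧
      (∀ A : Accel, ρ (E.incl A) = boostGen A) := by
  refine ⟨fun a ha => ⟨fun μ => ?_, fun α β => ?_, fun A => ?_⟩, isLieBracket_transGen_transGen,
    isLieBracket_lorentzGen_transGen, isLieBracket_lorentzGen_lorentzGen, fun A μ => ?_,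
    fun A α β => ?_, fun A B => ?_, ⟨fun _ _ => rfl⟩, not_finiteDimensional_accel,
    generatorExtension, liftPoincare, liftPoincare_injective, range_liftPoincare,
    isLieBracket_liftPoincare, fun A => ?_⟩
  · rw [transGen_eq_liftField]
    exact isInfinitesimalGeneralisedIsometry_liftField _ _ _ _ ha isMinkowskiSkew_zero
  · rw [lorentzGen_eq_liftField]
    exact isInfinitesimalGeneralisedIsometry_liftField _ _ _ _ ha
      (isMinkowskiSkew_lorentzMatrix α β)
  · rw [boostGen_eq_liftField]
    exact isInfinitesimalGeneralisedIsometry_liftField _ _ _ _ ha isMinkowskiSkew_zero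
  · rw [transGen_eq_liftField]
    exact isLieBracket_boostGen_liftField _ _ _ _
  · rw [lorentzGen_eq_liftField]
    exact isLieBracket_boostGen_liftField _ _ _ _
  · rw [boostGen_eq_liftField B]
    exact isLieBracket_boostGen_liftField _ _ _ _
  · rw [boostGen_eq_liftField]
    change liftField 0 (-op 0) A = _
    rw [map_zero, neg_zero]
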